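/- **Setting (fluid model on an overloaded interval).** Let $\tau,\mu>0$, $c_\lambda\in\mathbb R$. Let $\lambda>0$ be differentiable on $[0,\tau]$ with integrable derivative; let $s>0$ on $[0,\tau]$ be absolutely continuous with derivative $\dot s$ right-continuous with left limits and with finitely many discontinuities. Let $F$ be a c.d.f. on $[0,\infty)$ with $F(0)=0$, $F<1$, and continuous density $f>0$ on $[0,\infty)$; put $F^c=1-F$, $h_F=f/F^c$. Put $$b(t,0)=s(t)\mu+\dot s(t),\qquad \tilde q(t,x)=\lambda(t-x)F^c(x)\quad(0\le x\le t),$$ and assume $\inf_{[0,\tau]}b(\cdot,0)>0$. Let $w$ be continuous on $[0,\tau]$ with $0\le w(t)\le t$ and $w(t)=\int_0^t\bigl(1-b(u,0)/\tilde q(u,w(u))\bigr)du$ (the fluid head-of-line waiting time), and write $\dot w(t)=1-b(t,0)/\tilde q(t,w(t))$. Let $v$ (the fluid potential waiting time) satisfy $v(t-w(t))=w(t)$ for $t\in[0,\tau]$. Assume that the fluid content $X(t)=s(t)+\int_0^{w(t)}\tilde q(t,x)\,dx$ satisfies $X(t)>s(t)$ for $0<t<\tau$. Let $L(t)=t-w(t)$,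 with inverse $L^{-1}:[0,L(\tau)]\to[0,\tau]$, and $$F_w^c(t)=e^{-\int_0^t h_F(w(u))du},\qquad h(t)=\frac{b(t,0)\,\tilde q_x(t,w(t))}{\tilde q(t,w(t))^2},\qquad H(t,u)=e^{\int_u^t h(r)dr},$$ $$I_1(u)=\frac{c_\lambda\sqrt{F^c(w(u))b(u,0)}}{\tilde q(u,w(u))},\quad I_2(u)=-\frac{\sqrt{b(u,0)-\dot s(u)}}{\tilde q(u,w(u))},\quad I_3(u)=-\frac{\sqrt{F(w(u))b(u,0)}}{\tilde q(u,w(u))},$$ $$\bar I_1(u)=\frac{c_\lambda F^c(w(u))}{\tilde q(u,w(u))},\qquad \bar I_3(u)=-\frac{\sqrt{F^c(w(u))F(w(u))}}{\tilde q(u,w(u))},\qquad I^2=I_1^2+I_2^2+I_3^2,$$ $$J_i(t,u)=I_i(u)H(t,u),\qquad K_2(t,u)=\tilde q(t,w(t))J_2(t,u),$$ $$K_1(t,u)=c_\lambda F^c(t-u)\sqrt{\lambda(u)}\,1_{\{t-w(t)\le u\le t\}}+\tilde q(t,w(t))\sqrt{\lambda(u)}\,\bar I_1(L^{-1}(u))H(t,L^{-1}(u))\,1_{\{0\le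 u\le t-w(t)\}},$$ $$K_3(t,u)=-\sqrt{\lambda(u)F(t-u)F^c(t-u)}\,1_{\{t-w(t)\le u\le t\}}+\tilde q(t,w(t))\sqrt{\lambda(u)}\,\bar I_3(L^{-1}(u))H(t,L^{-1}(u))\,1_{\{0\le u\le t-w(t)\}}.$$ **Limit processes.** Let $B_1,B_2,B_3$ be independent standard Brownian motions and $\hat X(0)$ a random variable with finite variance, independent of $(B_1,B_2,B_3)$. With Wiener integrals, put $$\hat X_i^*(t)=\int_0^tK_i(t,u)\,dB_i(u),\quad \hat W_i^*(t)=\int_0^tJ_i(t,u)\,dB_i(u),\quad \hat X^*=\sum_{i=1}^3\hat X_i^*,\quad \hat W^*=\sum_{i=1}^3\hat W_i^*,$$ $$\hat X(t)=\hat X^*(t)+\hat X(0)F_w^c(t),\qquad \hat V^*(t)=\frac{\hat W^*(t+v(t))}{1-\dot w(t+v(t))},$$ $$\hat V(t)=\hat V^*(t)+\frac{\hat X(0)F_w^c(t+v(t))}{s(t+v(t))\mu+\dot s(t+v(t))},\qquad \hat W(t)=(1-\dot w(t))\,\hat V(t-w(t)).$$ Write $\sigma^2_Y(t)=\operatorname{Var}(Y(t))$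 and $\sigma^2_{Y,Z}(t)=\operatorname{Cov}(Y(t),Z(t))$. **Claim.** For every $t\in[0,\tau]$ the kernels $K_i(t,\cdot),J_i(t,\cdot)$ lie in $L^2(0,t)$, the variables $\hat X_i^*(t),\hat W_i^*(t)$ are square integrable, and $$\sigma^2_{\hat X}(t)=\sigma^2_{\hat X^*}(t)+\operatorname{Var}(\hat X(0))\,(F_w^c(t))^2,$$ $$\sigma^2_{\hat X^*}(t)=\sum_{i=1}^3\sigma^2_{\hat X_i^*}(t)=\int_0^t\sum_{i=1}^3K_i(t,u)^2du=\int_{t-w(t)}^t\lambda(u)F^c(t-u)\bigl(c_\lambda^2F^c(t-u)+F(t-u)\bigr)du+\tilde q(t,w(t))^2\sigma^2_{\hat W^*}(t),$$ $$\sigma^2_{\hat W^*}(t)=\sum_{i=1}^3\sigma^2_{\hat W_i^*}(t)=\int_0^t\sum_{i=1}^3J_i(t,u)^2du=\int_0^tH(t,u)^2I^2(u)\,du,$$ $$\sigma^2_{\hat W}(t)=(1-\dot w(t))^2\sigma^2_{\hat V}(t-w(t))=\sigma^2_{\hat W^*}(t)+\frac{\operatorname{Var}(\hat X(0))\,(F_w^c(t))^2}{\tilde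 q(t,w(t))^2},$$ $$\sigma^2_{\hat X^*,\hat W^*}(t)=\sum_{i=1}^3\sigma^2_{\hat X_i^*,\hat W_i^*}(t)=\int_0^t\sum_{i=1}^3J_i(t,u)K_i(t,u)\,du.$$ For every $t\in[0,\tau-w(\tau)]$ (equivalently $t+v(t)\in[0,\tau]$; this is all of $[0,\tau]$ if the interval ends with an empty queue), $$\sigma^2_{\hat V^*}(t)=\frac{\sigma^2_{\hat W^*}(t+v(t))}{(1-\dot w(t+v(t)))^2},\qquad \sigma^2_{\hat V}(t)=\sigma^2_{\hat V^*}(t)+\frac{\operatorname{Var}(\hat X(0))\,(F_w^c(t+v(t)))^2}{(s(t+v(t))\mu+\dot s(t+v(t)))^2}.$$ -/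

import Mathlib

open MeasureTheory ProbabilityTheory Set Filter Topology
open scoped NNReal ENNReal

noncomputable section

/-! ### The Wiener integral of a deterministic function -/

/-- A step function `∑ i, c i • 1_{(a i, b i]}` on the time interval `(0, T]`. -/
structure StepFn (T : ℝ) where
  n : ℕ
  c : Fin n → ℝ
  a : Fin n → ℝ≥0
  b : Fin n → ℝ≥0
  a_le_b : ∀ i, a i ≤ b i
  b_le : ∀ i, (b i : ℝ) ≤ T

namespace StepFn

/-- The function on the line given by a step function. -/
def toFun {T : ℝ} (φ : StepFn T) (u : ℝ) : ℝ :=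
  ∑ i, φ.c i * (Ioc (φ.a i : ℝ) (φ.b i : ℝ)).indicator (fun _ => (1 : ℝ)) u

/-- The elementary integral `∑ i, c i * (B (b i) - B (a i))` of a step function. -/
def integral {Ω : Type*} {T : ℝ} (φ : StepFn T) (B : ℝ≥0 → Ω → ℝ) (ω : Ω) : ℝ :=
  ∑ i, φ.c i * (B (φ.b i) ω - B (φ.a i) ω)

end StepFn

/-- `Y` is a version of the Wiener integral `∫₀ᵀ f(u) dB(u)`: the function `f` is in `L²(0,T]`, and
`Y` is the `L²(P)`-limit of the elementary integrals of step functions that converge to `f` in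
`L²(0,T]`. -/
def IsWienerIntegral {Ω : Type*} [MeasurableSpace Ω] (P : Measure Ω) (B : ℝ≥0 → Ω → ℝ)
    (T : ℝ) (f : ℝ → ℝ) (Y : Ω → ℝ) : Prop :=
  MemLp f 2 (volume.restrict (Ioc 0 T)) ∧ MemLp Y 2 P ∧
    ∃ φ : ℕ → StepFn T,
      Tendsto (fun n => eLpNorm (fun u => (φ n).toFun u - f u) 2 (volume.restrict (Ioc 0 T)))
        atTop (𝓝 0) ∧
      Tendsto (fun n => eLpNorm (fun ω => (φ n).integral B ω - Y ω) 2 P) atTop (𝓝 0)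

open Classical in
/-- The Wiener integral `∫₀ᵀ f(u) dB(u)` (a chosen version; it is unique up to a null set). -/
def wienerIntegral {Ω : Type*} [MeasurableSpace Ω] (P : Measure Ω) (B : ℝ≥0 → Ω → ℝ)
    (T : ℝ) (f : ℝ → ℝ) : Ω → ℝ :=
  if h : ∃ Y : Ω → ℝ, IsWienerIntegral P B T f Y then h.choose else 0

/-! ### The fluid model on an overloaded interval `[0, τ]` -/

/-- The functions and constants of the `G_t/M/s_t+GI` fluid model on the interval `[0, τ]`. -/
structure FluidData where
  /-- the length of the interval -/
  τ : ℝ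
  /-- the service rate of a server -/
  μ : ℝ
  /-- the arrival-process variability constant `c_λ` -/
  c : ℝ
  /-- the arrival rate `λ` -/
  lam : ℝ → ℝ
  /-- the staffing function `s` -/
  s : ℝ → ℝ
  /-- the derivative of the staffing function -/
  sdot : ℝ → ℝ
  /-- the patience cumulative distribution function -/
  F : ℝ → ℝ
  /-- the patience density -/
  f : ℝ → ℝ
  /-- the fluid head-of-line waiting time -/
  w : ℝ → ℝ
  /-- the fluid potential waiting time -/
  v : ℝ → ℝ

/-- `g` is right-continuous with left limits on `[0, τ]` and has only finitely many discontinuities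
there. -/
def IsPiecewiseContinuousOn (τ : ℝ) (g : ℝ → ℝ) : Prop :=
  (∀ t ∈ Ico 0 τ, ContinuousWithinAt g (Icc t τ) t) ∧
  (∀ t ∈ Ioc 0 τ, ∃ l : ℝ, Tendsto g (𝓝[Ico 0 t] t) (𝓝 l)) ∧
  {t ∈ Icc 0 τ | ¬ ContinuousWithinAt g (Icc 0 τ) t}.Finite

namespace FluidData

variable (M : FluidData)

/-- The complementary patience distribution function `F^c = 1 - F`. -/
def Fc (x : ℝ) : ℝ := 1 - M.F x

/-- The patience hazard rate `h_F = f / F^c`. -/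
def hF (x : ℝ) : ℝ := M.f x / M.Fc x

/-- The rate `b(t,0) = s(t) μ + s'(t)` at which fluid enters service. -/
def b (t : ℝ) : ℝ := M.s t * M.μ + M.sdot t

/-- The queue content density without flow into service, `q̃(t,x) = λ(t-x) F^c(x)`, `0 ≤ x ≤ t`. -/
def qt (t x : ℝ) : ℝ := M.lam (t - x) * M.Fc x

/-- The partial derivative `∂q̃/∂x` on the domain `0 ≤ x ≤ t` (one-sided at its ends). -/
def qtx (t x : ℝ) : ℝ := derivWithin (M.qt t) (Icc 0 t) x

/-- The derivative of the head-of-line waiting time, `w'(t) = 1 - b(t,0)/q̃(t,w(t))`; it is the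
right derivative of `w` at the finitely many times at which `s'` jumps. -/
def wdot (t : ℝ) : ℝ := 1 - M.b t / M.qt t (M.w t)

/-- The fluid queue content: the density is `q̃(t,x)` for `x ≤ w(t)` and zero beyond. -/
def Q (t : ℝ) : ℝ := ∫ x in (0 : ℝ)..M.w t, M.qt t x

/-- The fluid content of the system while the service facility is full. -/
def X (t : ℝ) : ℝ := M.s t + M.Q t

/-- `[0, τ]` is an overloaded interval with no critical loading except possibly at its endpoints,
the system being critically loaded with an empty queue at time `0`, and the model data satisfy the
smoothness and positivity conditions. -/
structure IsOverloaded : Prop where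
  τ_pos : 0 < M.τ
  μ_pos : 0 < M.μ
  /- the arrival rate is positive and differentiable, with integrable derivative -/
  lam_pos : ∀ t ∈ Icc 0 M.τ, 0 < M.lam t
  lam_diff : DifferentiableOn ℝ M.lam (Icc 0 M.τ)
  lam_deriv : IntegrableOn (derivWithin M.lam (Icc 0 M.τ)) (Icc 0 M.τ)
  /- the staffing function is positive and has a piecewise continuous derivative -/
  s_pos : ∀ t ∈ Icc 0 M.τ, 0 < M.s t
  sdot_pc : IsPiecewiseContinuousOn M.τ M.sdot
  s_eq : ∀ t ∈ Icc 0 M.τ, M.s t = M.s 0 + ∫ u in (0 : ℝ)..t, M.sdot u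
  /- the patience distribution has a continuous positive density and unbounded support -/
  F_zero : M.F 0 = 0
  F_deriv : ∀ x, 0 ≤ x → HasDerivWithinAt M.F (M.f x) (Ici 0) x
  F_lt_one : ∀ x, 0 ≤ x → M.F x < 1
  F_lim : Tendsto M.F atTop (𝓝 1)
  f_cont : ContinuousOn M.f (Ici 0)
  f_pos : ∀ x, 0 ≤ x → 0 < M.f x
  /- the rate of flow into service is bounded away from zero -/
  b_inf : ∃ b₀ > 0, ∀ t ∈ Icc 0 M.τ, b₀ ≤ M.b t
  /- the head-of-line waiting time solves its integral equation -/
  w_cont : ContinuousOn M.w (Icc 0 M.τ)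
  w_mem : ∀ t ∈ Icc 0 M.τ, 0 ≤ M.w t ∧ M.w t ≤ t
  w_eq : ∀ t ∈ Icc 0 M.τ, M.w t = ∫ u in (0 : ℝ)..t, (1 - M.b u / M.qt u (M.w u))
  /- the potential waiting time at `t - w(t)` is `w(t)` -/
  v_eq : ∀ t ∈ Icc 0 M.τ, M.v (t - M.w t) = M.w t
  /- the system is strictly overloaded inside the interval -/
  overloaded : ∀ t ∈ Ioo 0 M.τ, M.s t < M.X t

/-! ### The kernels -/

/-- `F_w^c(t) = exp(-∫₀ᵗ h_F(w(u)) du)`. -/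
def Fwc (t : ℝ) : ℝ := Real.exp (-∫ u in (0 : ℝ)..t, M.hF (M.w u))

/-- `h(t) = b(t,0) q̃_x(t,w(t)) / q̃(t,w(t))²`. -/
def h (t : ℝ) : ℝ := M.b t * M.qtx t (M.w t) / M.qt t (M.w t) ^ 2

/-- `H(t,u) = exp(∫_u^t h(r) dr)`. -/
def H (t u : ℝ) : ℝ := Real.exp (∫ r in u..t, M.h r)

/-- `L(t) = t - w(t)`. -/
def L (t : ℝ) : ℝ := t - M.w t

/-- The inverse of `L : [0, τ] → [0, L(τ)]`. -/
def Linv (u : ℝ) : ℝ := Function.invFunOn M.L (Icc 0 M.τ) u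

/-- The functions `I₁ = I_λ`, `I₂ = I_s`, `I₃ = I_a`, indexed by `0, 1, 2`. -/
def I (i : Fin 3) (u : ℝ) : ℝ :=
  ![M.c * √(M.Fc (M.w u) * M.b u) / M.qt u (M.w u),
    -√(M.b u - M.sdot u) / M.qt u (M.w u),
    -√(M.F (M.w u) * M.b u) / M.qt u (M.w u)] i

/-- `I² = I₁² + I₂² + I₃²`. -/
def Isq (u : ℝ) : ℝ := ∑ i, M.I i u ^ 2

/-- `Ī₁`. -/
def Ibar₁ (u : ℝ) : ℝ := M.c * M.Fc (M.w u) / M.qt u (M.w u)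

/-- `Ī₃`. -/
def Ibar₃ (u : ℝ) : ℝ := -√(M.Fc (M.w u) * M.F (M.w u)) / M.qt u (M.w u)

/-- The kernels `Jᵢ(t,u) = Iᵢ(u) H(t,u)`. -/
def J (i : Fin 3) (t u : ℝ) : ℝ := M.I i u * M.H t u

/-- The kernel `K₁`. -/
def K₁ (t u : ℝ) : ℝ :=
  (Icc (t - M.w t) t).indicator (fun u => M.c * M.Fc (t - u) * √(M.lam u)) u +
  (Icc 0 (t - M.w t)).indicator
    (fun u => M.qt t (M.w t) * √(M.lam u) * M.Ibar₁ (M.Linv u) * M.H t (M.Linv u)) u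

/-- The kernel `K₂`. -/
def K₂ (t u : ℝ) : ℝ := M.qt t (M.w t) * M.J 1 t u

/-- The kernel `K₃`. -/
def K₃ (t u : ℝ) : ℝ :=
  (Icc (t - M.w t) t).indicator (fun u => -√(M.lam u * M.F (t - u) * M.Fc (t - u))) u +
  (Icc 0 (t - M.w t)).indicator
    (fun u => M.qt t (M.w t) * √(M.lam u) * M.Ibar₃ (M.Linv u) * M.H t (M.Linv u)) u

/-- The kernels `K₁ = K_λ`, `K₂ = K_s`, `K₃ = K_a`, indexed by `0, 1, 2`. -/
def K (i : Fin 3) (t u : ℝ) : ℝ := ![M.K₁ t u, M.K₂ t u, M.K₃ t u] i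

/-! ### The limit processes

`B 0`, `B 1`, `B 2` are the Brownian motions of the arrival process, of the service times and of
the patience times, and `X0` is the limit of the scaled initial content. -/

variable {Ω : Type*} [MeasurableSpace Ω] (P : Measure Ω) (B : Fin 3 → ℝ≥0 → Ω → ℝ) (X0 : Ω → ℝ)

/-- `X̂*ᵢ(t) = ∫₀ᵗ Kᵢ(t,u) dBᵢ(u)`. -/
def XstarComp (i : Fin 3) (t : ℝ) : Ω → ℝ := wienerIntegral P (B i) t (M.K i t)

/-- `Ŵ*ᵢ(t) = ∫₀ᵗ Jᵢ(t,u) dBᵢ(u)`. -/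
def WstarComp (i : Fin 3) (t : ℝ) : Ω → ℝ := wienerIntegral P (B i) t (M.J i t)

/-- `X̂* = X̂*₁ + X̂*₂ + X̂*₃`. -/
def Xstar (t : ℝ) (ω : Ω) : ℝ := ∑ i, M.XstarComp P B i t ω

/-- `Ŵ* = Ŵ*₁ + Ŵ*₂ + Ŵ*₃`. -/
def Wstar (t : ℝ) (ω : Ω) : ℝ := ∑ i, M.WstarComp P B i t ω

/-- `X̂(t) = X̂*(t) + X̂(0) F_w^c(t)`. -/
def Xhat (t : ℝ) (ω : Ω) : ℝ := M.Xstar P B t ω + X0 ω * M.Fwc t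

/-- `V̂*(t) = Ŵ*(t + v(t)) / (1 - w'(t + v(t)))`. -/
def Vstar (t : ℝ) (ω : Ω) : ℝ := M.Wstar P B (t + M.v t) ω / (1 - M.wdot (t + M.v t))

/-- `V̂(t) = V̂*(t) + X̂(0) F_w^c(t + v(t)) / (s(t + v(t)) μ + s'(t + v(t)))`. -/
def Vhat (t : ℝ) (ω : Ω) : ℝ :=
  M.Vstar P B t ω +
    X0 ω * M.Fwc (t + M.v t) / (M.s (t + M.v t) * M.μ + M.sdot (t + M.v t))

/-- `Ŵ(t) = (1 - w'(t)) V̂(t - w(t))`. -/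
def What (t : ℝ) (ω : Ω) : ℝ := (1 - M.wdot t) * M.Vhat P B X0 (t - M.w t) ω

end FluidData

end

/-!
The variance formulas rest on two facts, one probabilistic and one about the fluid model.

The probabilistic fact is the isometry of the Wiener integral. For step functions, the mixed second
moment of two elementary integrals is read off from `E[B(s) B(t)] = min s t`; step functions are
dense in `L²(0, T]` (`StepFn.exists_eLpNorm_sub_le`), so the elementary integrals of an
approximating sequence converge in `L²(P)` (`IsWienerIntegral.exists_of_memLp`) and the identity
passes to the limit (`IsWienerIntegral.integral_mul`). The same computation with `E[X(s) Y(t)] = 0`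
shows that integrals against independent Brownian motions are uncorrelated, and a random variable
independent of the Brownian motions is uncorrelated with all integrals. Hence all cross terms vanish
(`covariance_sum_wienerIntegral`, `covariance_sum_wienerIntegral_of_indepFun`), and each remaining
covariance is an integral of a product of two kernels. The independence of `X0` enters only through
these covariances.

The fluid fact is the substitution `u = L(s)`, where `L(s) = s - w(s)` is strictly increasing with
`L' = b / q̃` off the finitely many jump times of `s'` (`integral_comp_L`). Since
`λ(L(s)) = q̃(s,w(s)) / F^c(w(s))`, it turns the part of `K₁(t,·)²` and `K₃(t,·)²` on `[0, L(t)]`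
into `q̃(t,w(t))² J₁(t,·)²` and `q̃(t,w(t))² J₃(t,·)²` on `[0, t]`; what remains is the integral over
the fluid still waiting at time `t` (`integral_sum_K_sq`). The same substitution makes `h`
integrable, because `h` contains `λ'` only in the combination `(λ' ∘ L) L'` (`integrableOn_h`).
Therefore `H(t,·)` is continuous, and the kernels are square integrable (`memLp_J`, `memLp_K`).

The formulas for the waiting times follow from `L(t) + v(L(t)) = t` and `1 - w' = b / q̃`.
-/

/-! ### Inner products and limits in `L²` -/

theorem inner_toLp_eq_integral_mul {α : Type*} [MeasurableSpace α] {μ : Measure α} {X Y : α → ℝ}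
    (hX : MemLp X 2 μ) (hY : MemLp Y 2 μ) :
    inner ℝ (hX.toLp X) (hY.toLp Y) = ∫ a, X a * Y a ∂μ := by
  rw [L2.inner_def]
  refine integral_congr_ae ?_
  filter_upwards [hX.coeFn_toLp, hY.coeFn_toLp] with a h1 h2
  simp [h1, h2, mul_comm]

theorem tendsto_integral_mul_of_tendsto_eLpNorm {α : Type*} [MeasurableSpace α] {μ : Measure α}
    {X Y : ℕ → α → ℝ} {X' Y' : α → ℝ} (hX : ∀ n, MemLp (X n) 2 μ) (hY : ∀ n, MemLp (Y n) 2 μ)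
    (hX' : MemLp X' 2 μ) (hY' : MemLp Y' 2 μ)
    (hXX' : Tendsto (fun n => eLpNorm (fun a => X n a - X' a) 2 μ) atTop (𝓝 0))
    (hYY' : Tendsto (fun n => eLpNorm (fun a => Y n a - Y' a) 2 μ) atTop (𝓝 0)) :
    Tendsto (fun n => ∫ a, X n a * Y n a ∂μ) atTop (𝓝 (∫ a, X' a * Y' a ∂μ)) := by
  have h1 := (Lp.tendsto_Lp_iff_tendsto_eLpNorm'' X hX X' hX').2 hXX'
  have h2 := (Lp.tendsto_Lp_iff_tendsto_eLpNorm'' Y hY Y' hY').2 hYY'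
  have h := h1.inner (𝕜 := ℝ) h2
  simpa only [inner_toLp_eq_integral_mul] using h

theorem tendsto_integral_const_mul_of_tendsto_eLpNorm {α : Type*} [MeasurableSpace α]
    {μ : Measure α} {X : ℕ → α → ℝ} {X' Z : α → ℝ} (hZ : MemLp Z 2 μ)
    (hX : ∀ n, MemLp (X n) 2 μ) (hX' : MemLp X' 2 μ)
    (hXX' : Tendsto (fun n => eLpNorm (fun a => X n a - X' a) 2 μ) atTop (𝓝 0)) :
    Tendsto (fun n => ∫ a, Z a * X n a ∂μ) atTop (𝓝 (∫ a, Z a * X' a ∂μ)) :=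
  tendsto_integral_mul_of_tendsto_eLpNorm (fun _ => hZ) hX hZ hX' (by simp) hXX'

/-- The product of two differences of square-integrable functions, integrated term by term. -/
theorem integral_sub_mul_sub {α : Type*} [MeasurableSpace α] {μ : Measure α} {X Y Z W : α → ℝ}
    (hX : MemLp X 2 μ) (hY : MemLp Y 2 μ) (hZ : MemLp Z 2 μ) (hW : MemLp W 2 μ) :
    ∫ a, (X a - Y a) * (Z a - W a) ∂μ =
      ∫ a, X a * Z a ∂μ - ∫ a, X a * W a ∂μ - ∫ a, Y a * Z a ∂μ + ∫ a, Y a * W a ∂μ := by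
  simp only [← inner_toLp_eq_integral_mul, hX, hY, hZ, hW]
  refine (inner_toLp_eq_integral_mul (hX.sub hY) (hZ.sub hW)).symm.trans ?_
  rw [MemLp.toLp_sub hX hY, MemLp.toLp_sub hZ hW, inner_sub_left, inner_sub_right, inner_sub_right]
  ring

/-- The product of two linear combinations of square-integrable functions, integrated term by
term. -/
theorem integral_sum_mul_sum {α : Type*} [MeasurableSpace α] {μ : Measure α} {m n : ℕ}
    (c : Fin m → ℝ) (d : Fin n → ℝ) {X : Fin m → α → ℝ} {Y : Fin n → α → ℝ}
    (hX : ∀ i, MemLp (X i) 2 μ) (hY : ∀ j, MemLp (Y j) 2 μ) :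
    ∫ a, (∑ i, c i * X i a) * (∑ j, d j * Y j a) ∂μ =
      ∑ i, ∑ j, c i * d j * ∫ a, X i a * Y j a ∂μ := by
  have hint : ∀ i j, Integrable (fun a => c i * X i a * (d j * Y j a)) μ := fun i j =>
    ((hX i).const_mul (c i)).integrable_mul ((hY j).const_mul (d j))
  simp only [Finset.sum_mul_sum]
  rw [integral_finsetSum _ fun i _ => integrable_finsetSum _ fun j _ => hint i j]
  refine Finset.sum_congr rfl fun i _ => ?_
  rw [integral_finsetSum _ fun j _ => hint i j]
  refine Finset.sum_congr rfl fun j _ => ?_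
  rw [← integral_const_mul]
  congr 1
  funext a
  ring

/-! ### Step functions and their elementary integrals -/

namespace StepFn

variable {Ω : Type*} [MeasurableSpace Ω] {P : Measure Ω} {T : ℝ}

theorem memLp_toFun (φ : StepFn T) : MemLp φ.toFun 2 (volume.restrict (Ioc 0 T)) := by
  unfold toFun
  refine memLp_finsetSum _ fun i _ => MemLp.const_mul ?_ _
  exact (memLp_const (1 : ℝ)).indicator measurableSet_Ioc

theorem memLp_integral (φ : StepFn T) {B : ℝ≥0 → Ω → ℝ} (hB : ∀ s, MemLp (B s) 2 P) :
    MemLp (φ.integral B) 2 P := by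
  unfold integral
  exact memLp_finsetSum _ fun i _ => ((hB _).sub (hB _)).const_mul _

theorem integral_indicator_Ioc_mul_indicator_Ioc {s t : ℝ≥0} (hs : (s : ℝ) ≤ T) :
    ∫ u in Ioc 0 T, (Ioc 0 (s : ℝ)).indicator (fun _ => (1 : ℝ)) u *
      (Ioc 0 (t : ℝ)).indicator (fun _ => (1 : ℝ)) u = min s t := by
  have h : (fun u => (Ioc 0 (s : ℝ)).indicator (fun _ => (1 : ℝ)) u *
      (Ioc 0 (t : ℝ)).indicator (fun _ => (1 : ℝ)) u) =
      (Ioc 0 (min (s : ℝ) t)).indicator (fun _ => (1 : ℝ)) := by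
    funext u
    rw [← inter_indicator_mul]
    simp [Ioc_inter_Ioc]
  rw [h, setIntegral_indicator measurableSet_Ioc, Ioc_inter_Ioc]
  simp [hs]

theorem indicator_Ioc_eq_sub {a b : ℝ≥0} (hab : a ≤ b) (u : ℝ) :
    (Ioc (a : ℝ) b).indicator (fun _ => (1 : ℝ)) u =
      (Ioc 0 (b : ℝ)).indicator (fun _ => (1 : ℝ)) u -
        (Ioc 0 (a : ℝ)).indicator (fun _ => (1 : ℝ)) u := by
  have h0 : (0 : ℝ) ≤ a := a.2
  have h1 : (a : ℝ) ≤ b := hab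
  simp only [indicator, mem_Ioc]
  split_ifs <;> grind

/-- The elementary integrals with respect to two processes whose mixed second moments are a
multiple `κ` of those of Brownian motion. The case `κ = 1` is the isometry for one Brownian motion,
the case `κ = 0` is the orthogonality of the integrals against two independent ones. -/
theorem integral_integral_mul_integral {X Y : ℝ≥0 → Ω → ℝ} {κ : ℝ} (hX : ∀ s, MemLp (X s) 2 P)
    (hY : ∀ s, MemLp (Y s) 2 P) (hXY : ∀ s t, ∫ ω, X s ω * Y t ω ∂P = κ * min s t)
    (φ ψ : StepFn T) :
    ∫ ω, φ.integral X ω * ψ.integral Y ω ∂P =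
      κ * ∫ u in Ioc 0 T, φ.toFun u * ψ.toFun u := by
  unfold integral toFun
  have hI : ∀ x y : ℝ, MemLp ((Ioc x y).indicator fun _ => (1 : ℝ)) 2
      (volume.restrict (Ioc 0 T)) := fun x y =>
    (memLp_const (1 : ℝ)).indicator measurableSet_Ioc
  refine (integral_sum_mul_sum φ.c ψ.c (fun i => (hX (φ.b i)).sub (hX (φ.a i)))
      (fun j => (hY (ψ.b j)).sub (hY (ψ.a j)))).trans ?_
  rw [integral_sum_mul_sum φ.c ψ.c (fun i => hI _ _) (fun j => hI _ _), Finset.mul_sum]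
  refine Finset.sum_congr rfl fun i _ => ?_
  rw [Finset.mul_sum]
  refine Finset.sum_congr rfl fun j _ => ?_
  have ha : ((φ.a i : ℝ≥0) : ℝ) ≤ T := le_trans (by exact_mod_cast φ.a_le_b i) (φ.b_le i)
  simp only [indicator_Ioc_eq_sub (φ.a_le_b i), indicator_Ioc_eq_sub (ψ.a_le_b j), Pi.sub_apply]
  rw [integral_sub_mul_sub (hX _) (hX _) (hY _) (hY _),
    integral_sub_mul_sub (hI _ _) (hI _ _) (hI _ _) (hI _ _)]
  simp only [hXY, integral_indicator_Ioc_mul_indicator_Ioc (φ.b_le i),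
    integral_indicator_Ioc_mul_indicator_Ioc ha]
  ring

/-- A random variable orthogonal to a process is orthogonal to its elementary integrals. -/
theorem integral_mul_integral_eq_zero {B : ℝ≥0 → Ω → ℝ} (hB : ∀ s, MemLp (B s) 2 P) {Z : Ω → ℝ}
    (hZ : MemLp Z 2 P) (hZB : ∀ s, ∫ ω, Z ω * B s ω ∂P = 0) (φ : StepFn T) :
    ∫ ω, Z ω * φ.integral B ω ∂P = 0 := by
  have h : ∀ i, Integrable (fun ω => Z ω * (φ.c i * (B (φ.b i) ω - B (φ.a i) ω))) P := fun i =>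
    hZ.integrable_mul (((hB _).sub (hB _)).const_mul (φ.c i))
  simp only [integral, Finset.mul_sum]
  rw [integral_finsetSum _ fun i _ => h i]
  refine Finset.sum_eq_zero fun i _ => ?_
  have e : (fun ω => Z ω * (φ.c i * (B (φ.b i) ω - B (φ.a i) ω))) =
      fun ω => φ.c i * (Z ω * B (φ.b i) ω - Z ω * B (φ.a i) ω) := by
    funext ω
    ring
  rw [e, integral_const_mul, integral_sub (f := fun ω => Z ω * B (φ.b i) ω)
    (g := fun ω => Z ω * B (φ.a i) ω) (hZ.integrable_mul (hB _)) (hZ.integrable_mul (hB _)),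
    hZB, hZB]
  simp

/-- The step function with the value `g (k T / N)` on `(k T / N, (k + 1) T / N]`. -/
noncomputable def sample (g : ℝ → ℝ) (hT : 0 ≤ T) (N : ℕ) (hN : 0 < N) : StepFn T where
  n := N
  c k := g (k * T / N)
  a k := (k * T / N).toNNReal
  b k := ((k + 1) * T / N).toNNReal
  a_le_b k := by
    refine Real.toNNReal_le_toNNReal ?_
    gcongr
    simp
  b_le k := by
    have h : ((k : ℕ) : ℝ) + 1 ≤ N := by exact_mod_cast k.2
    have hN' : (0 : ℝ) < N := by exact_mod_cast hN
    rw [Real.coe_toNNReal _ (by positivity), div_le_iff₀ hN']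
    nlinarith

theorem exists_sample_toFun_eq (g : ℝ → ℝ) (hT : 0 ≤ T) (N : ℕ) (hN : 0 < N) {u : ℝ}
    (hu : u ∈ Ioc 0 T) :
    ∃ x ∈ Icc 0 T, |x - u| ≤ T / N ∧ (sample g hT N hN).toFun u = g x := by
  have hT' : 0 < T := hu.1.trans_le hu.2
  have hN' : (0 : ℝ) < N := by exact_mod_cast hN
  set m := ⌈u * N / T⌉₊ with hm
  have hm0 : 0 < m := Nat.ceil_pos.2 (div_pos (mul_pos hu.1 hN') hT')
  have hmN : m ≤ N := Nat.ceil_le.2 (by rw [div_le_iff₀ hT']; nlinarith [hu.2])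
  have key : ∀ k : ℕ, u ∈ Ioc ((k : ℝ) * T / N) ((k + 1) * T / N) ↔ k + 1 = m := by
    intro k
    have e : k + 1 = m ↔ (k : ℝ) < u * N / T ∧ u * N / T ≤ ((k + 1 : ℕ) : ℝ) := by
      rw [← Nat.lt_ceil, ← Nat.ceil_le, ← hm]
      omega
    rw [e, mem_Ioc, div_lt_iff₀ hN', lt_div_iff₀ hT', le_div_iff₀ hN', div_le_iff₀ hT']
    push_cast
    rfl
  obtain ⟨k, hkm⟩ : ∃ k, m = k + 1 := ⟨m - 1, by omega⟩
  have hk : u ∈ Ioc ((k : ℝ) * T / N) ((k + 1) * T / N) := (key k).2 (by omega)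
  have hw : ((k : ℝ) + 1) * T / N = k * T / N + T / N := by ring
  refine ⟨k * T / N, ⟨by positivity, hk.1.le.trans hu.2⟩, ?_, ?_⟩
  · rw [abs_sub_comm, abs_of_pos (by linarith [hk.1])]
    linarith [hk.2]
  · have hcoe : ∀ j : Fin N, (Ioc (((sample g hT N hN).a j : ℝ≥0) : ℝ)
        ((sample g hT N hN).b j : ℝ≥0)) = Ioc (((j : ℕ) : ℝ) * T / N) (((j : ℕ) + 1) * T / N) :=
      fun j => by
        simp only [sample]
        rw [Real.coe_toNNReal _ (by positivity), Real.coe_toNNReal _ (by positivity)]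
    unfold toFun
    refine (Finset.sum_eq_single (⟨k, by omega⟩ : Fin N) ?_
      (fun h => absurd (Finset.mem_univ _) h)).trans ?_
    rotate_left
    · rw [hcoe, indicator_of_mem hk, mul_one]
      rfl
    · intro j _ hj
      rw [hcoe, indicator_of_notMem, mul_zero]
      rw [key]
      intro h
      exact hj (Fin.ext (by simp only; omega))

/-- Step functions are dense in `L²(0, T]`. -/
theorem exists_eLpNorm_sub_le {f : ℝ → ℝ} (hT : 0 ≤ T)
    (hf : MemLp f 2 (volume.restrict (Ioc 0 T))) {ε : ℝ≥0∞} (hε : ε ≠ 0) :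
    ∃ φ : StepFn T, eLpNorm (fun u => φ.toFun u - f u) 2 (volume.restrict (Ioc 0 T)) ≤ ε := by
  obtain ⟨g, hg, hgL⟩ := hf.exists_boundedContinuous_eLpNorm_sub_le (by simp)
    (ENNReal.half_pos hε).ne'
  -- a uniform error `δ` on `(0, T]` costs at most `T ^ (1 / 2) * δ` in `L²`
  obtain ⟨δ, hδ, hδε⟩ : ∃ δ : ℝ, 0 < δ ∧
      (volume.restrict (Ioc 0 T)) univ ^ (2 : ℝ≥0∞).toReal⁻¹ * ENNReal.ofReal δ ≤ ε / 2 := by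
    set A : ℝ≥0∞ := (volume.restrict (Ioc 0 T)) univ ^ (2 : ℝ≥0∞).toReal⁻¹
    have hA : A ≠ ∞ := ENNReal.rpow_ne_top_of_nonneg (by simp) (by simp)
    have hlim : Tendsto (fun δ : ℝ => A * ENNReal.ofReal δ) (𝓝[>] 0) (𝓝 0) := by
      have h := ENNReal.Tendsto.const_mul (a := A)
        (ENNReal.tendsto_ofReal (tendsto_nhdsWithin_of_tendsto_nhds (s := Ioi (0 : ℝ)) tendsto_id))
        (Or.inr hA) (b := ENNReal.ofReal 0) (f := 𝓝[>] (0 : ℝ))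
      simpa using h
    have h1 := hlim.eventually (Iic_mem_nhds (ENNReal.half_pos hε))
    obtain ⟨δ, h2, h3⟩ := (h1.and self_mem_nhdsWithin).exists
    exact ⟨δ, h3, h2⟩
  have hu := (isCompact_Icc (a := 0) (b := T)).uniformContinuousOn_of_continuous
    g.continuous.continuousOn
  obtain ⟨η, hη, hηδ⟩ := Metric.uniformContinuousOn_iff.1 hu δ hδ
  obtain ⟨N, hN⟩ := exists_nat_gt (T / η)
  have hN0' : (0 : ℝ) < N := (div_nonneg hT hη.le).trans_lt hN
  have hN0 : 0 < N := by exact_mod_cast hN0'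
  refine ⟨sample g hT N hN0, ?_⟩
  have hsub : (fun u => (sample g hT N hN0).toFun u - f u) =
      (fun u => (sample g hT N hN0).toFun u - g u) + (-(f - g)) := by
    funext u
    simp
  rw [hsub]
  refine (eLpNorm_add_le ((memLp_toFun _).sub hgL).1 (hf.sub hgL).neg.1 (by norm_num)).trans ?_
  rw [eLpNorm_neg]
  refine (add_le_add ?_ hg).trans (ENNReal.add_halves ε).le
  refine (eLpNorm_le_of_ae_bound (C := δ) ?_).trans hδε
  filter_upwards [ae_restrict_mem measurableSet_Ioc] with u hu
  obtain ⟨x, hx, hxu, hval⟩ := exists_sample_toFun_eq g hT N hN0 hu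
  rw [Pi.sub_apply, hval, ← dist_eq_norm]
  refine (hηδ x hx u ⟨hu.1.le, hu.2⟩ ?_).le
  rw [Real.dist_eq]
  refine hxu.trans_lt ?_
  rw [div_lt_iff₀ hN0', mul_comm]
  exact (div_lt_iff₀ hη).1 hN

end StepFn

/-! ### The Wiener integral -/

section Wiener

variable {Ω : Type*} [MeasurableSpace Ω] {P : Measure Ω} {T : ℝ}

namespace IsWienerIntegral

/-- The isometry of the Wiener integral (`κ = 1`, `X = Y`) and the orthogonality of integrals
against independent Brownian motions (`κ = 0`). -/
theorem integral_mul {X Y : ℝ≥0 → Ω → ℝ} {κ : ℝ} (hX : ∀ s, MemLp (X s) 2 P)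
    (hY : ∀ s, MemLp (Y s) 2 P) (hXY : ∀ s t, ∫ ω, X s ω * Y t ω ∂P = κ * min s t)
    {f g : ℝ → ℝ} {U V : Ω → ℝ} (hU : IsWienerIntegral P X T f U)
    (hV : IsWienerIntegral P Y T g V) :
    ∫ ω, U ω * V ω ∂P = κ * ∫ u in Ioc 0 T, f u * g u := by
  obtain ⟨hf, hU, φ, hφf, hφU⟩ := hU
  obtain ⟨hg, hV, ψ, hψg, hψV⟩ := hV
  have h1 := tendsto_integral_mul_of_tendsto_eLpNorm (fun n => (φ n).memLp_integral hX)
    (fun n => (ψ n).memLp_integral hY) hU hV hφU hψV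
  have h2 := (tendsto_integral_mul_of_tendsto_eLpNorm (fun n => (φ n).memLp_toFun)
    (fun n => (ψ n).memLp_toFun) hf hg hφf hψg).const_mul κ
  simp only [StepFn.integral_integral_mul_integral hX hY hXY] at h1
  exact tendsto_nhds_unique h1 h2

theorem integral_mul_eq_zero {B : ℝ≥0 → Ω → ℝ} (hB : ∀ s, MemLp (B s) 2 P) {Z : Ω → ℝ}
    (hZ : MemLp Z 2 P) (hZB : ∀ s, ∫ ω, Z ω * B s ω ∂P = 0) {f : ℝ → ℝ} {Y : Ω → ℝ}
    (hY : IsWienerIntegral P B T f Y) : ∫ ω, Z ω * Y ω ∂P = 0 := by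
  obtain ⟨-, hY, φ, -, hφY⟩ := hY
  have h := tendsto_integral_const_mul_of_tendsto_eLpNorm hZ
    (fun n => (φ n).memLp_integral hB) hY hφY
  simp only [StepFn.integral_mul_integral_eq_zero hB hZ hZB] at h
  exact tendsto_nhds_unique h tendsto_const_nhds

/-- Every function in `L²(0, T]` has a Wiener integral: by the isometry, the elementary integrals of
step functions approximating it form a Cauchy sequence in `L²(P)`. -/
theorem exists_of_memLp {B : ℝ≥0 → Ω → ℝ} (hB : ∀ s, MemLp (B s) 2 P)
    (hBB : ∀ s t, ∫ ω, B s ω * B t ω ∂P = min s t) (hT : 0 ≤ T) {f : ℝ → ℝ}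
    (hf : MemLp f 2 (volume.restrict (Ioc 0 T))) : ∃ Y, IsWienerIntegral P B T f Y := by
  have hpos : ∀ n : ℕ, ((n : ℝ≥0∞) + 1)⁻¹ ≠ 0 := fun n => by
    simp [ENNReal.add_eq_top]
  choose φ hφ using fun n : ℕ => StepFn.exists_eLpNorm_sub_le hT hf (hpos n)
  have hφf : Tendsto (fun n => eLpNorm (fun u => (φ n).toFun u - f u) 2
      (volume.restrict (Ioc 0 T))) atTop (𝓝 0) := by
    refine tendsto_of_tendsto_of_tendsto_of_le_of_le tendsto_const_nhds ?_ (fun _ => zero_le) hφ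
    have h := (tendsto_add_atTop_iff_nat 1).2 ENNReal.tendsto_inv_nat_nhds_zero
    simpa using h
  have hL := (Lp.tendsto_Lp_iff_tendsto_eLpNorm'' (fun n => (φ n).toFun)
    (fun n => (φ n).memLp_toFun) f hf).2 hφf
  set x := fun n => ((φ n).memLp_toFun).toLp (φ n).toFun
  set y := fun n => ((φ n).memLp_integral hB).toLp ((φ n).integral B) with hy
  have hinner : ∀ m n, inner ℝ (y m) (y n) = inner ℝ (x m) (x n) := fun m n => by
    rw [inner_toLp_eq_integral_mul, inner_toLp_eq_integral_mul,
      StepFn.integral_integral_mul_integral (κ := 1) hB hB (by simpa using hBB), one_mul]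
  have hdist : ∀ m n, dist (y m) (y n) = dist (x m) (x n) := fun m n => by
    rw [dist_eq_norm, dist_eq_norm, ← sq_eq_sq₀ (norm_nonneg _) (norm_nonneg _),
      norm_sub_sq_real, norm_sub_sq_real]
    simp only [← real_inner_self_eq_norm_sq, hinner]
  have hc : CauchySeq y := by
    have h := hL.cauchySeq
    rw [Metric.cauchySeq_iff] at h ⊢
    simpa only [hdist] using h
  obtain ⟨z, hz⟩ := cauchySeq_tendsto_of_complete hc
  refine ⟨z, hf, Lp.memLp z, φ, hφf, ?_⟩
  rw [← Lp.toLp_coeFn z (Lp.memLp z), hy, Lp.tendsto_Lp_iff_tendsto_eLpNorm''] at hz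
  exact hz

end IsWienerIntegral

theorem isWienerIntegral_wienerIntegral {B : ℝ≥0 → Ω → ℝ} (hB : ∀ s, MemLp (B s) 2 P)
    (hBB : ∀ s t, ∫ ω, B s ω * B t ω ∂P = min s t) (hT : 0 ≤ T) {f : ℝ → ℝ}
    (hf : MemLp f 2 (volume.restrict (Ioc 0 T))) :
    IsWienerIntegral P B T f (wienerIntegral P B T f) := by
  have h := IsWienerIntegral.exists_of_memLp hB hBB hT hf
  rw [wienerIntegral, dif_pos h]
  exact h.choose_spec

theorem ProbabilityTheory.IsPreBrownianReal.memLp_two {B : ℝ≥0 → Ω → ℝ}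
    (hB : IsPreBrownianReal B P) (t : ℝ≥0) : MemLp (B t) 2 P :=
  (hB.isGaussianProcess.hasGaussianLaw_eval t).memLp_two

theorem ProbabilityTheory.IsPreBrownianReal.integral_mul [IsProbabilityMeasure P]
    {B : ℝ≥0 → Ω → ℝ} (hB : IsPreBrownianReal B P) (s t : ℝ≥0) :
    ∫ ω, B s ω * B t ω ∂P = min s t := by
  have h := covariance_eq_sub (hB.memLp_two s) (hB.memLp_two t)
  rw [hB.covariance_eval, hB.integral_eval] at h
  simpa using h.symm

section Family

variable [IsProbabilityMeasure P] {ι : Type*} {B : ι → ℝ≥0 → Ω → ℝ}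

theorem memLp_wienerIntegral {i : ι} (hB : IsPreBrownianReal (B i) P) (hT : 0 ≤ T) {f : ℝ → ℝ}
    (hf : MemLp f 2 (volume.restrict (Ioc 0 T))) : MemLp (wienerIntegral P (B i) T f) 2 P :=
  (isWienerIntegral_wienerIntegral hB.memLp_two hB.integral_mul hT hf).2.1

theorem integral_wienerIntegral {i : ι} (hB : IsPreBrownianReal (B i) P) (hT : 0 ≤ T) {f : ℝ → ℝ}
    (hf : MemLp f 2 (volume.restrict (Ioc 0 T))) :
    ∫ ω, wienerIntegral P (B i) T f ω ∂P = 0 := by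
  have h := (isWienerIntegral_wienerIntegral hB.memLp_two hB.integral_mul hT hf)
  have h' := h.integral_mul_eq_zero hB.memLp_two (memLp_const (1 : ℝ)) (fun s => by
    simpa using hB.integral_eval s)
  simpa using h'

theorem covariance_wienerIntegral_self {i : ι} (hB : IsPreBrownianReal (B i) P) (hT : 0 ≤ T)
    {f g : ℝ → ℝ} (hf : MemLp f 2 (volume.restrict (Ioc 0 T)))
    (hg : MemLp g 2 (volume.restrict (Ioc 0 T))) :
    cov[wienerIntegral P (B i) T f, wienerIntegral P (B i) T g; P] =
      ∫ u in Ioc 0 T, f u * g u := by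
  have h1 := isWienerIntegral_wienerIntegral hB.memLp_two hB.integral_mul hT hf
  have h2 := isWienerIntegral_wienerIntegral hB.memLp_two hB.integral_mul hT hg
  rw [covariance_eq_sub h1.2.1 h2.2.1, integral_wienerIntegral hB hT hf, zero_mul, sub_zero]
  simpa using h1.integral_mul (κ := 1) hB.memLp_two hB.memLp_two
    (by simpa using hB.integral_mul) h2

theorem covariance_wienerIntegral_of_ne (hB : ∀ i, IsPreBrownianReal (B i) P)
    (hind : iIndepFun (fun i ω t => B i t ω) P) (hT : 0 ≤ T) {i j : ι} (hij : i ≠ j)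
    {f g : ℝ → ℝ} (hf : MemLp f 2 (volume.restrict (Ioc 0 T)))
    (hg : MemLp g 2 (volume.restrict (Ioc 0 T))) :
    cov[wienerIntegral P (B i) T f, wienerIntegral P (B j) T g; P] = 0 := by
  have h1 := isWienerIntegral_wienerIntegral (hB i).memLp_two (hB i).integral_mul hT hf
  have h2 := isWienerIntegral_wienerIntegral (hB j).memLp_two (hB j).integral_mul hT hg
  rw [covariance_eq_sub h1.2.1 h2.2.1, integral_wienerIntegral (hB i) hT hf, zero_mul, sub_zero]
  have h0 : ∀ s t, ∫ ω, B i s ω * B j t ω ∂P = 0 * min s t := fun s t => by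
    have h := (hind.indepFun hij).comp (measurable_pi_apply s) (measurable_pi_apply t)
    have h' := h.integral_fun_mul_eq_mul_integral ((hB i).memLp_two s).1 ((hB j).memLp_two t).1
    have h0 : ∫ ω, B i s ω ∂P = 0 := (hB i).integral_eval s
    simp only [Function.comp_apply, h0, zero_mul] at h' ⊢
    exact h'
  simpa using h1.integral_mul (hB i).memLp_two (hB j).memLp_two h0 h2

theorem covariance_wienerIntegral_of_indepFun (hB : ∀ i, IsPreBrownianReal (B i) P) {Z : Ω → ℝ}
    (hZ : MemLp Z 2 P) (hind : IndepFun Z (fun ω i t => B i t ω) P) (hT : 0 ≤ T) (i : ι)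
    {f : ℝ → ℝ} (hf : MemLp f 2 (volume.restrict (Ioc 0 T))) :
    cov[wienerIntegral P (B i) T f, Z; P] = 0 := by
  have h1 := isWienerIntegral_wienerIntegral (hB i).memLp_two (hB i).integral_mul hT hf
  rw [covariance_comm, covariance_eq_sub hZ h1.2.1, integral_wienerIntegral (hB i) hT hf,
    mul_zero, sub_zero]
  refine h1.integral_mul_eq_zero (hB i).memLp_two hZ fun s => ?_
  have h := hind.comp measurable_id
    ((measurable_pi_apply s).comp (measurable_pi_apply (X := fun _ : ι => ℝ≥0 → ℝ) i))
  have h' := h.integral_fun_mul_eq_mul_integral hZ.1 ((hB i).memLp_two s).1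
  have h0 : ∫ ω, B i s ω ∂P = 0 := (hB i).integral_eval s
  simp only [Function.comp_apply, id, h0, mul_zero] at h'
  exact h'

/-- The covariance of two sums of Wiener integrals against independent Brownian motions. -/
theorem covariance_sum_wienerIntegral [Fintype ι] (hB : ∀ i, IsPreBrownianReal (B i) P)
    (hind : iIndepFun (fun i ω t => B i t ω) P) (hT : 0 ≤ T) {f g : ι → ℝ → ℝ}
    (hf : ∀ i, MemLp (f i) 2 (volume.restrict (Ioc 0 T)))
    (hg : ∀ i, MemLp (g i) 2 (volume.restrict (Ioc 0 T))) :
    cov[fun ω => ∑ i, wienerIntegral P (B i) T (f i) ω,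
      fun ω => ∑ i, wienerIntegral P (B i) T (g i) ω; P] =
      ∑ i, cov[wienerIntegral P (B i) T (f i), wienerIntegral P (B i) T (g i); P] := by
  rw [covariance_fun_sum_fun_sum (fun i => memLp_wienerIntegral (hB i) hT (hf i))
    (fun i => memLp_wienerIntegral (hB i) hT (hg i))]
  refine Finset.sum_congr rfl fun i _ => Finset.sum_eq_single i (fun j _ hj => ?_) (by simp)
  exact covariance_wienerIntegral_of_ne hB hind hT hj.symm (hf i) (hg j)

theorem sum_covariance_wienerIntegral [Fintype ι] (hB : ∀ i, IsPreBrownianReal (B i) P)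
    (hT : 0 ≤ T) {f g : ι → ℝ → ℝ}
    (hf : ∀ i, MemLp (f i) 2 (volume.restrict (Ioc 0 T)))
    (hg : ∀ i, MemLp (g i) 2 (volume.restrict (Ioc 0 T))) :
    ∑ i, cov[wienerIntegral P (B i) T (f i), wienerIntegral P (B i) T (g i); P] =
      ∫ u in (0 : ℝ)..T, ∑ i, f i u * g i u := by
  rw [intervalIntegral.integral_of_le hT,
    integral_finsetSum (f := fun i u => f i u * g i u) _
      fun i _ => (hf i).integrable_mul (hg i)]
  exact Finset.sum_congr rfl fun i _ => covariance_wienerIntegral_self (hB i) hT (hf i) (hg i)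

theorem covariance_sum_wienerIntegral_of_indepFun [Fintype ι]
    (hB : ∀ i, IsPreBrownianReal (B i) P) {Z : Ω → ℝ} (hZ : MemLp Z 2 P)
    (hind : IndepFun Z (fun ω i t => B i t ω) P) (hT : 0 ≤ T) {f : ι → ℝ → ℝ}
    (hf : ∀ i, MemLp (f i) 2 (volume.restrict (Ioc 0 T))) :
    cov[fun ω => ∑ i, wienerIntegral P (B i) T (f i) ω, Z; P] = 0 := by
  rw [covariance_fun_sum_left (fun i => memLp_wienerIntegral (hB i) hT (hf i)) hZ]
  exact Finset.sum_eq_zero fun i _ => covariance_wienerIntegral_of_indepFun hB hZ hind hT i (hf i)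

end Family

end Wiener

/-! ### Piecewise continuous functions, inverses on compact sets -/

namespace IsPiecewiseContinuousOn

variable {τ : ℝ} {g : ℝ → ℝ}

/-- A function with one-sided limits everywhere is locally bounded, hence bounded on `[0, τ]`. -/
theorem exists_bound (hg : IsPiecewiseContinuousOn τ g) : ∃ C, ∀ t ∈ Icc 0 τ, |g t| ≤ C := by
  obtain ⟨hright, hleft, -⟩ := hg
  refine isCompact_Icc.induction_on (p := fun s => ∃ C, ∀ t ∈ s, |g t| ≤ C) ⟨0, by simp⟩
    (fun s t hst ⟨C, hC⟩ => ⟨C, fun x hx => hC x (hst hx)⟩)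
    (fun s t ⟨C, hC⟩ ⟨D, hD⟩ => ⟨max C D, fun x hx => hx.elim
      (fun h => (hC x h).trans (le_max_left _ _)) fun h => (hD x h).trans (le_max_right _ _)⟩) ?_
  intro t ht
  have hR : ∃ C, ∀ᶠ x in 𝓝[Icc t τ] t, |g x| ≤ C := by
    rcases ht.2.eq_or_lt with h | h
    · refine ⟨|g t|, ?_⟩
      filter_upwards [self_mem_nhdsWithin] with x hx
      rw [show x = t by linarith [hx.1, hx.2]]
    · exact ⟨|g t| + 1, ((hright t ⟨ht.1, h⟩).abs.eventually (gt_mem_nhds (lt_add_one _))).mono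
        fun _ => le_of_lt⟩
  have hL : ∃ C, ∀ᶠ x in 𝓝[Ico 0 t] t, |g x| ≤ C := by
    rcases ht.1.eq_or_lt with h | h
    · exact ⟨0, by simp [← h]⟩
    · obtain ⟨l, hl⟩ := hleft t ⟨h, ht.2⟩
      exact ⟨|l| + 1, (hl.abs.eventually (gt_mem_nhds (lt_add_one _))).mono fun _ => le_of_lt⟩
  obtain ⟨C, hC⟩ := hR
  obtain ⟨D, hD⟩ := hL
  refine ⟨{x | |g x| ≤ max C D}, ?_, max C D, fun x hx => hx⟩
  rw [← Ico_union_Icc_eq_Icc ht.1 ht.2, nhdsWithin_union, mem_sup]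
  exact ⟨hD.mono fun x hx => hx.trans (le_max_right _ _),
    hC.mono fun x hx => hx.trans (le_max_left _ _)⟩

theorem aestronglyMeasurable (hg : IsPiecewiseContinuousOn τ g) :
    AEStronglyMeasurable g (volume.restrict (Icc 0 τ)) := by
  obtain ⟨-, -, hfin⟩ := hg
  set D := {t ∈ Icc 0 τ | ¬ ContinuousWithinAt g (Icc 0 τ) t} with hD
  have hc : ContinuousOn g (Icc 0 τ \ D) := fun t ht => by
    have h : ContinuousWithinAt g (Icc 0 τ) t := by
      by_contra h
      exact ht.2 ⟨ht.1, h⟩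
    exact h.mono sdiff_subset
  have h := hc.aestronglyMeasurable (μ := volume) (measurableSet_Icc.diff hfin.measurableSet)
  rwa [Measure.restrict_congr_set (sdiff_null_ae_eq_self (hfin.measure_zero volume))] at h

theorem integrableOn (hg : IsPiecewiseContinuousOn τ g) : IntegrableOn g (Icc 0 τ) := by
  obtain ⟨C, hC⟩ := hg.exists_bound
  refine Integrable.of_bound hg.aestronglyMeasurable C ?_
  filter_upwards [ae_restrict_mem measurableSet_Icc] with x hx using hC x hx

end IsPiecewiseContinuousOn

theorem continuousOn_invFunOn_of_isCompact {K : Set ℝ} {f : ℝ → ℝ} (hK : IsCompact K)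
    (hf : ContinuousOn f K) (hinj : InjOn f K) :
    ContinuousOn (Function.invFunOn f K) (f '' K) := by
  rw [continuousOn_iff_isClosed]
  intro C hC
  refine ⟨f '' (K ∩ C), ((hK.inter_right hC).image_of_continuousOn
    (hf.mono inter_subset_left)).isClosed, ?_⟩
  have hl := hinj.leftInvOn_invFunOn
  ext y
  constructor
  · rintro ⟨hy, x, hx, rfl⟩
    rw [mem_preimage, hl hx] at hy
    exact ⟨⟨x, ⟨hx, hy⟩, rfl⟩, ⟨x, hx, rfl⟩⟩
  · rintro ⟨⟨x, ⟨hx, hxC⟩, rfl⟩, hy⟩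
    exact ⟨by rw [mem_preimage, hl hx]; exact hxC, hy⟩

/-! ### Functions glued from two continuous pieces -/

section Glue

variable {a t : ℝ} {A B : ℝ → ℝ}

theorem ContinuousOn.memLp_Icc {p : ℝ≥0∞} {x y : ℝ} (hA : ContinuousOn A (Icc x y)) :
    MemLp A p (volume.restrict (Icc x y)) := by
  obtain ⟨C, hC⟩ := isCompact_Icc.exists_bound_of_continuousOn hA
  refine MemLp.of_bound (hA.aestronglyMeasurable measurableSet_Icc) C ?_
  filter_upwards [ae_restrict_mem measurableSet_Icc] with x hx using hC x hx

theorem memLp_indicator_add_indicator (hA : ContinuousOn A (Icc a t))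
    (hB : ContinuousOn B (Icc 0 a)) :
    MemLp (fun u => (Icc a t).indicator A u + (Icc 0 a).indicator B u) 2
      (volume.restrict (Ioc 0 t)) := by
  refine MemLp.add ?_ ?_
  · exact ((memLp_indicator_iff_restrict measurableSet_Icc).2 hA.memLp_Icc).restrict _
  · exact ((memLp_indicator_iff_restrict measurableSet_Icc).2 hB.memLp_Icc).restrict _

/-- The two pieces overlap in the single point `a` only, which the integral does not see. -/
theorem integral_indicator_add_indicator_sq (ha : a ∈ Icc 0 t) (hA : ContinuousOn A (Icc a t))
    (hB : ContinuousOn B (Icc 0 a)) :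
    ∫ u in (0 : ℝ)..t, ((Icc a t).indicator A u + (Icc 0 a).indicator B u) ^ 2 =
      (∫ u in (0 : ℝ)..a, B u ^ 2) + ∫ u in a..t, A u ^ 2 := by
  have hsq := (memLp_indicator_add_indicator hA hB).integrable_sq
  have hint : IntervalIntegrable
      (fun u => ((Icc a t).indicator A u + (Icc 0 a).indicator B u) ^ 2) volume 0 t :=
    (intervalIntegrable_iff_integrableOn_Ioc_of_le (ha.1.trans ha.2)).2 hsq
  rw [← intervalIntegral.integral_add_adjacent_intervals
    (hint.mono_set (by rw [uIcc_of_le ha.1, uIcc_of_le (ha.1.trans ha.2)]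
                       exact Icc_subset_Icc_right ha.2))
    (hint.mono_set (by rw [uIcc_of_le ha.2, uIcc_of_le (ha.1.trans ha.2)]
                       exact Icc_subset_Icc_left ha.1))]
  congr 1
  · rw [intervalIntegral.integral_of_le ha.1, intervalIntegral.integral_of_le ha.1,
      integral_Ioc_eq_integral_Ioo, integral_Ioc_eq_integral_Ioo]
    refine setIntegral_congr_fun measurableSet_Ioo fun u hu => ?_
    rw [indicator_of_notMem (fun h => absurd h.1 (not_le.2 hu.2)),
      indicator_of_mem (Ioo_subset_Icc_self hu), zero_add]
  · rw [intervalIntegral.integral_of_le ha.2, intervalIntegral.integral_of_le ha.2]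
    refine setIntegral_congr_fun measurableSet_Ioc fun u hu => ?_
    rw [indicator_of_mem (Ioc_subset_Icc_self hu),
      indicator_of_notMem (fun h => absurd h.2 (not_le.2 hu.1)), add_zero]

end Glue

/-! ### Regularity of the fluid model -/

namespace FluidData.IsOverloaded

variable {M : FluidData}

theorem continuousOn_F (hM : M.IsOverloaded) : ContinuousOn M.F (Ici 0) := fun x hx =>
  (hM.F_deriv x hx).continuousWithinAt

theorem hasDerivAt_F (hM : M.IsOverloaded) {x : ℝ} (hx : 0 < x) : HasDerivAt M.F (M.f x) x :=
  (hM.F_deriv x hx.le).hasDerivAt (Ici_mem_nhds hx)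

theorem F_nonneg (hM : M.IsOverloaded) {x : ℝ} (hx : 0 ≤ x) : 0 ≤ M.F x := by
  have hmono : MonotoneOn M.F (Ici 0) := by
    refine monotoneOn_of_deriv_nonneg (convex_Ici 0) hM.continuousOn_F ?_ ?_
    · rw [interior_Ici]
      exact fun y hy => (hM.hasDerivAt_F hy).differentiableAt.differentiableWithinAt
    · rw [interior_Ici]
      intro y hy
      rw [(hM.hasDerivAt_F hy).deriv]
      exact (hM.f_pos y (le_of_lt hy)).le
  rw [← hM.F_zero]
  exact hmono (mem_Ici.2 le_rfl) hx hx

theorem Fc_pos (hM : M.IsOverloaded) {x : ℝ} (hx : 0 ≤ x) : 0 < M.Fc x :=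
  sub_pos.2 (hM.F_lt_one x hx)

theorem continuousOn_Fc (hM : M.IsOverloaded) : ContinuousOn M.Fc (Ici 0) :=
  continuousOn_const.sub hM.continuousOn_F

theorem mapsTo_w (hM : M.IsOverloaded) : MapsTo M.w (Icc 0 M.τ) (Ici 0) := fun t ht =>
  (hM.w_mem t ht).1

theorem mapsTo_L (hM : M.IsOverloaded) : MapsTo M.L (Icc 0 M.τ) (Icc 0 M.τ) := fun t ht =>
  ⟨sub_nonneg.2 (hM.w_mem t ht).2, (sub_le_self _ (hM.w_mem t ht).1).trans ht.2⟩

theorem L_mem_Icc (hM : M.IsOverloaded) {t : ℝ} (ht : t ∈ Icc 0 M.τ) : M.L t ∈ Icc 0 t :=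
  ⟨sub_nonneg.2 (hM.w_mem t ht).2, sub_le_self _ (hM.w_mem t ht).1⟩

theorem continuousOn_L (hM : M.IsOverloaded) : ContinuousOn M.L (Icc 0 M.τ) :=
  continuousOn_id.sub hM.w_cont

theorem L_zero (hM : M.IsOverloaded) : M.L 0 = 0 :=
  le_antisymm (hM.L_mem_Icc ⟨le_rfl, hM.τ_pos.le⟩).2 (hM.L_mem_Icc ⟨le_rfl, hM.τ_pos.le⟩).1

theorem continuousOn_lam_L (hM : M.IsOverloaded) :
    ContinuousOn (fun t => M.lam (M.L t)) (Icc 0 M.τ) :=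
  hM.lam_diff.continuousOn.comp hM.continuousOn_L hM.mapsTo_L

theorem continuousOn_Fc_w (hM : M.IsOverloaded) :
    ContinuousOn (fun t => M.Fc (M.w t)) (Icc 0 M.τ) :=
  hM.continuousOn_Fc.comp hM.w_cont hM.mapsTo_w

theorem continuousOn_F_w (hM : M.IsOverloaded) :
    ContinuousOn (fun t => M.F (M.w t)) (Icc 0 M.τ) :=
  hM.continuousOn_F.comp hM.w_cont hM.mapsTo_w

theorem Fc_w_pos (hM : M.IsOverloaded) {t : ℝ} (ht : t ∈ Icc 0 M.τ) : 0 < M.Fc (M.w t) :=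
  hM.Fc_pos (hM.mapsTo_w ht)

theorem lam_L_pos (hM : M.IsOverloaded) {t : ℝ} (ht : t ∈ Icc 0 M.τ) : 0 < M.lam (M.L t) :=
  hM.lam_pos _ (hM.mapsTo_L ht)

theorem continuousOn_qt_w (hM : M.IsOverloaded) :
    ContinuousOn (fun t => M.qt t (M.w t)) (Icc 0 M.τ) :=
  hM.continuousOn_lam_L.mul hM.continuousOn_Fc_w

theorem qt_w_pos (hM : M.IsOverloaded) {t : ℝ} (ht : t ∈ Icc 0 M.τ) : 0 < M.qt t (M.w t) :=
  mul_pos (hM.lam_L_pos ht) (hM.Fc_w_pos ht)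

theorem continuousOn_s (hM : M.IsOverloaded) : ContinuousOn M.s (Icc 0 M.τ) := by
  have h : ContinuousOn (fun t => M.s 0 + ∫ u in (0 : ℝ)..t, M.sdot u) (Icc 0 M.τ) := by
    refine continuousOn_const.add ?_
    rw [← uIcc_of_le hM.τ_pos.le]
    refine intervalIntegral.continuousOn_primitive_interval ?_
    rw [uIcc_of_le hM.τ_pos.le]
    exact hM.sdot_pc.integrableOn
  exact h.congr hM.s_eq

theorem b_pos (hM : M.IsOverloaded) {t : ℝ} (ht : t ∈ Icc 0 M.τ) : 0 < M.b t := by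
  obtain ⟨b₀, h0, hb⟩ := hM.b_inf
  exact h0.trans_le (hb t ht)

theorem integrableOn_b (hM : M.IsOverloaded) : IntegrableOn M.b (Icc 0 M.τ) :=
  ((hM.continuousOn_s.mul continuousOn_const).integrableOn_Icc).add hM.sdot_pc.integrableOn

theorem integrableOn_b_div_qt (hM : M.IsOverloaded) :
    IntegrableOn (fun t => M.b t / M.qt t (M.w t)) (Icc 0 M.τ) := by
  simp only [div_eq_mul_inv]
  exact hM.integrableOn_b.mul_continuousOn
    (hM.continuousOn_qt_w.inv₀ fun t ht => (hM.qt_w_pos ht).ne') isCompact_Icc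

theorem intervalIntegrable_b_div_qt (hM : M.IsOverloaded) {s t : ℝ} (hs : s ∈ Icc 0 M.τ)
    (ht : t ∈ Icc 0 M.τ) :
    IntervalIntegrable (fun t => M.b t / M.qt t (M.w t)) volume s t :=
  (hM.integrableOn_b_div_qt.mono_set (uIcc_subset_Icc hs ht)).intervalIntegrable

/-- `L` is the integral of the speed `b / q̃` at which the head of the line moves. -/
theorem L_eq_integral (hM : M.IsOverloaded) {t : ℝ} (ht : t ∈ Icc 0 M.τ) :
    M.L t = ∫ u in (0 : ℝ)..t, M.b u / M.qt u (M.w u) := by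
  rw [L, hM.w_eq t ht, intervalIntegral.integral_sub (by simp)
    (hM.intervalIntegrable_b_div_qt ⟨le_rfl, hM.τ_pos.le⟩ ht)]
  simp

theorem strictMonoOn_L (hM : M.IsOverloaded) : StrictMonoOn M.L (Icc 0 M.τ) := by
  intro s hs t ht hst
  have h0 : (0 : ℝ) ∈ Icc 0 M.τ := ⟨le_rfl, hM.τ_pos.le⟩
  rw [← sub_pos, hM.L_eq_integral hs, hM.L_eq_integral ht,
    intervalIntegral.integral_interval_sub_left (hM.intervalIntegrable_b_div_qt h0 ht)
      (hM.intervalIntegrable_b_div_qt h0 hs)]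
  refine intervalIntegral.intervalIntegral_pos_of_pos_on (hM.intervalIntegrable_b_div_qt hs ht)
    (fun u hu => ?_) hst
  have hu' : u ∈ Icc 0 M.τ := ⟨hs.1.trans hu.1.le, hu.2.le.trans ht.2⟩
  exact div_pos (hM.b_pos hu') (hM.qt_w_pos hu')

theorem hasDerivAt_L (hM : M.IsOverloaded) {t : ℝ} (ht : t ∈ Ioo 0 M.τ)
    (hc : ContinuousWithinAt M.sdot (Icc 0 M.τ) t) :
    HasDerivAt M.L (M.b t / M.qt t (M.w t)) t := by
  have hnhds : Icc 0 M.τ ∈ 𝓝 t := Icc_mem_nhds ht.1 ht.2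
  have ht' := Ioo_subset_Icc_self ht
  have hb : ContinuousAt M.b t :=
    ((hM.continuousOn_s.continuousAt hnhds).mul continuousAt_const).add (hc.continuousAt hnhds)
  have h := intervalIntegral.integral_hasDerivAt_right
    (hM.intervalIntegrable_b_div_qt ⟨le_rfl, hM.τ_pos.le⟩ ht')
    ⟨_, hnhds, hM.integrableOn_b_div_qt.aestronglyMeasurable⟩
    (hb.div (hM.continuousOn_qt_w.continuousAt hnhds) (hM.qt_w_pos ht').ne')
  refine h.congr_of_eventuallyEq ?_
  filter_upwards [hnhds] with u hu using hM.L_eq_integral hu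

theorem image_L_Icc (hM : M.IsOverloaded) {t : ℝ} (ht : t ∈ Icc 0 M.τ) :
    M.L '' Icc 0 t = Icc 0 (M.L t) := by
  have hsub : Icc 0 t ⊆ Icc 0 M.τ := Icc_subset_Icc_right ht.2
  rw [(hM.continuousOn_L.mono hsub).image_Icc_of_monotoneOn ht.1
    (hM.strictMonoOn_L.monotoneOn.mono hsub), hM.L_zero]

/-! ### The substitution `u = L(s)` -/

/-- `L` is differentiable off the finitely many jumps of `s'`; neither these times nor their images
under `L` matter for an integral. -/
theorem exists_regular_times (hM : M.IsOverloaded) {t : ℝ} (ht : t ∈ Icc 0 M.τ) :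
    ∃ S : Set ℝ, MeasurableSet S ∧ S ⊆ Ioo 0 t ∧ S =ᵐ[volume] Ioc 0 t ∧
      M.L '' S =ᵐ[volume] Ioc 0 (M.L t) ∧
      ∀ u ∈ S, HasDerivWithinAt M.L (M.b u / M.qt u (M.w u)) S u := by
  have hfin := hM.sdot_pc.2.2
  set D := {t ∈ Icc 0 M.τ | ¬ ContinuousWithinAt M.sdot (Icc 0 M.τ) t} with hD
  have hE : (D ∪ {0, t}).Finite := hfin.union (by simp)
  have hsub : Icc 0 t ⊆ Icc 0 M.τ := Icc_subset_Icc_right ht.2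
  have hS : Ioo 0 t \ D = Icc 0 t \ (D ∪ {0, t}) := by
    ext x
    simp only [Set.mem_sdiff, mem_Ioo, mem_Icc, mem_union, mem_insert_iff, mem_singleton_iff]
    grind
  refine ⟨Ioo 0 t \ D, measurableSet_Ioo.diff hfin.measurableSet, sdiff_subset,
    (sdiff_null_ae_eq_self (hfin.measure_zero volume)).trans Ioo_ae_eq_Ioc, ?_, fun u hu => ?_⟩
  · refine EventuallyEq.trans ?_ (Ioc_ae_eq_Icc (a := 0) (b := M.L t)).symm
    rw [hS, ae_eq_set]
    refine ⟨?_, measure_mono_null (t := M.L '' (D ∪ {0, t})) ?_ ((hE.image _).measure_zero volume)⟩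
    · rw [sdiff_eq_empty.2, measure_empty]
      rw [← hM.image_L_Icc ht]
      exact image_mono sdiff_subset
    · rw [← hM.image_L_Icc ht]
      rintro _ ⟨⟨x, hx, rfl⟩, h⟩
      by_contra h'
      exact h ⟨x, ⟨hx, fun h'' => h' ⟨x, h'', rfl⟩⟩, rfl⟩
  · have hu' : u ∈ Ioo 0 M.τ := ⟨hu.1.1, hu.1.2.trans_le ht.2⟩
    refine (hM.hasDerivAt_L hu' ?_).hasDerivWithinAt
    by_contra h
    exact hu.2 ⟨Ioo_subset_Icc_self hu', h⟩

theorem integral_comp_L (hM : M.IsOverloaded) {t : ℝ} (ht : t ∈ Icc 0 M.τ) (g : ℝ → ℝ) :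
    ∫ u in (0 : ℝ)..M.L t, g u =
      ∫ s in (0 : ℝ)..t, M.b s / M.qt s (M.w s) * g (M.L s) := by
  obtain ⟨S, hSm, hSt, hS, hLS, hder⟩ := hM.exists_regular_times ht
  have hsub : S ⊆ Icc 0 M.τ :=
    (hSt.trans Ioo_subset_Icc_self).trans (Icc_subset_Icc_right ht.2)
  rw [intervalIntegral.integral_of_le (hM.L_mem_Icc ht).1, intervalIntegral.integral_of_le ht.1,
    ← setIntegral_congr_set hLS, ← setIntegral_congr_set hS,
    integral_image_eq_integral_deriv_smul_of_monotoneOn hSm hder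
      (hM.strictMonoOn_L.monotoneOn.mono hsub)]
  rfl

theorem integrableOn_comp_L (hM : M.IsOverloaded) {g : ℝ → ℝ} (hg : IntegrableOn g (Icc 0 M.τ)) :
    IntegrableOn (fun s => M.b s / M.qt s (M.w s) * g (M.L s)) (Icc 0 M.τ) := by
  have hτ : M.τ ∈ Icc 0 M.τ := ⟨hM.τ_pos.le, le_rfl⟩
  obtain ⟨S, hSm, hSt, hS, hLS, hder⟩ := hM.exists_regular_times hτ
  have h := integrableOn_image_iff_integrableOn_deriv_smul_of_monotoneOn hSm hder
      (hM.strictMonoOn_L.monotoneOn.mono (hSt.trans Ioo_subset_Icc_self)) g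
  rw [integrableOn_congr_set_ae hLS, integrableOn_congr_set_ae hS,
    ← integrableOn_Icc_iff_integrableOn_Ioc, ← integrableOn_Icc_iff_integrableOn_Ioc] at h
  exact h.1 (hg.mono_set (Icc_subset_Icc_right (hM.mapsTo_L hτ).2))

/-! ### Continuity of `H` and of the inverse of `L` -/

/-- The queue is nonempty inside the interval. -/
theorem w_pos (hM : M.IsOverloaded) {t : ℝ} (ht : t ∈ Ioo 0 M.τ) : 0 < M.w t := by
  refine lt_of_le_of_ne (hM.w_mem t (Ioo_subset_Icc_self ht)).1 fun h => ?_
  have := hM.overloaded t ht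
  simp [X, Q, ← h] at this

theorem qtx_w_eq (hM : M.IsOverloaded) {t : ℝ} (ht : t ∈ Ioo 0 M.τ) :
    M.qtx t (M.w t) = -derivWithin M.lam (Icc 0 M.τ) (M.L t) * M.Fc (M.w t) -
      M.lam (M.L t) * M.f (M.w t) := by
  have ht' := Ioo_subset_Icc_self ht
  have hw := hM.w_pos ht
  have hL0 : 0 < M.L t := by
    rw [← hM.L_zero]
    exact hM.strictMonoOn_L ⟨le_rfl, hM.τ_pos.le⟩ ht' ht.1
  have hL1 : M.L t < M.τ := (hM.L_mem_Icc ht').2.trans_lt ht.2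
  have hwt : M.w t < t := sub_pos.1 hL0
  have hlam : HasDerivAt M.lam (derivWithin M.lam (Icc 0 M.τ) (M.L t)) (M.L t) :=
    ((hM.lam_diff _ (hM.mapsTo_L ht')).hasDerivWithinAt).hasDerivAt (Icc_mem_nhds hL0 hL1)
  have h1 : HasDerivAt (fun x => M.lam (t - x)) (-derivWithin M.lam (Icc 0 M.τ) (M.L t))
      (M.w t) := by
    have h := HasDerivAt.comp (M.w t) (h₂ := M.lam) (h := fun x => t - x) hlam
      ((hasDerivAt_id (M.w t)).const_sub t)
    simpa [Function.comp_def] using h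
  have h2 : HasDerivAt M.Fc (-M.f (M.w t)) (M.w t) := (hM.hasDerivAt_F hw).const_sub 1
  have h := h1.mul h2
  unfold qtx
  rw [derivWithin_of_mem_nhds (Icc_mem_nhds hw hwt)]
  refine (HasDerivAt.deriv (f := M.qt t) h).trans ?_
  rw [← L]
  ring

/-- Up to bounded continuous factors, `h` is a combination of `b` and of `(λ' ∘ L) L'`; the latter
is integrable because `λ'` is. -/
theorem integrableOn_h (hM : M.IsOverloaded) : IntegrableOn M.h (Icc 0 M.τ) := by
  have hq : ∀ t ∈ Icc 0 M.τ, M.qt t (M.w t) ≠ 0 := fun t ht => (hM.qt_w_pos ht).ne'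
  have hf : ContinuousOn (fun t => M.f (M.w t)) (Icc 0 M.τ) :=
    hM.f_cont.comp hM.w_cont hM.mapsTo_w
  have h1 := (hM.integrableOn_comp_L hM.lam_deriv).mul_continuousOn
    ((hM.continuousOn_Fc_w.div hM.continuousOn_qt_w hq).neg) isCompact_Icc
  have h2 := hM.integrableOn_b.mul_continuousOn
    (((hM.continuousOn_lam_L.mul hf).div (hM.continuousOn_qt_w.pow 2)
      fun t ht => pow_ne_zero 2 (hq t ht)).neg) isCompact_Icc
  have hsum := h1.add h2
  rw [integrableOn_Icc_iff_integrableOn_Ioo] at hsum ⊢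
  refine hsum.congr_fun (fun t ht => ?_) measurableSet_Ioo
  have hqt := hq t (Ioo_subset_Icc_self ht)
  simp only [FluidData.h, Pi.add_apply, Pi.neg_apply, Pi.div_apply, Pi.mul_apply, Pi.pow_apply,
    hM.qtx_w_eq ht]
  field_simp
  ring

theorem continuousOn_H (hM : M.IsOverloaded) {t : ℝ} (ht : t ∈ Icc 0 M.τ) :
    ContinuousOn (M.H t) (Icc 0 M.τ) := by
  unfold H
  refine Real.continuous_exp.comp_continuousOn ?_
  rw [← uIcc_of_le hM.τ_pos.le]
  have hint : IntegrableOn M.h (uIcc 0 M.τ) := by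
    rw [uIcc_of_le hM.τ_pos.le]
    exact hM.integrableOn_h
  rw [← uIcc_of_le hM.τ_pos.le] at ht
  simp only [fun u => intervalIntegral.integral_symm (f := M.h) (μ := volume) t u]
  exact (intervalIntegral.continuousOn_primitive_interval'
    hint.intervalIntegrable ht).neg

theorem Linv_L (hM : M.IsOverloaded) {t : ℝ} (ht : t ∈ Icc 0 M.τ) : M.Linv (M.L t) = t :=
  hM.strictMonoOn_L.injOn.leftInvOn_invFunOn ht

theorem continuousOn_Linv (hM : M.IsOverloaded) {t : ℝ} (ht : t ∈ Icc 0 M.τ) :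
    ContinuousOn M.Linv (Icc 0 (M.L t)) := by
  rw [← hM.image_L_Icc ht]
  exact (continuousOn_invFunOn_of_isCompact isCompact_Icc hM.continuousOn_L
    hM.strictMonoOn_L.injOn).mono (image_mono (Icc_subset_Icc_right ht.2))

theorem mapsTo_Linv (hM : M.IsOverloaded) {t : ℝ} (ht : t ∈ Icc 0 M.τ) :
    MapsTo M.Linv (Icc 0 (M.L t)) (Icc 0 M.τ) := by
  rw [← hM.image_L_Icc ht]
  rintro _ ⟨x, hx, rfl⟩
  have hx' : x ∈ Icc 0 M.τ := ⟨hx.1, hx.2.trans ht.2⟩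
  rwa [hM.Linv_L hx']

/-! ### The kernels -/

theorem memLp_sqrt_b (hM : M.IsOverloaded) :
    MemLp (fun u => √(M.b u)) 2 (volume.restrict (Icc 0 M.τ)) := by
  have hm := hM.integrableOn_b.aestronglyMeasurable
  rw [memLp_two_iff_integrable_sq (Real.continuous_sqrt.comp_aestronglyMeasurable hm)]
  refine hM.integrableOn_b.congr_fun (fun u hu => ?_) measurableSet_Icc
  exact (Real.sq_sqrt (hM.b_pos hu).le).symm

theorem memLp_continuousOn_mul {T : ℝ} {g f : ℝ → ℝ} (hg : ContinuousOn g (Icc 0 T))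
    (hf : MemLp f 2 (volume.restrict (Icc 0 T))) :
    MemLp (fun u => g u * f u) 2 (volume.restrict (Icc 0 T)) := by
  obtain ⟨C, hC⟩ := isCompact_Icc.exists_bound_of_continuousOn hg
  refine hf.of_le_mul (c := C) ((hg.aestronglyMeasurable measurableSet_Icc).mul hf.1) ?_
  filter_upwards [ae_restrict_mem measurableSet_Icc] with x hx
  rw [norm_mul]
  exact mul_le_mul_of_nonneg_right (hC x hx) (norm_nonneg _)

theorem memLp_I (hM : M.IsOverloaded) (i : Fin 3) :
    MemLp (M.I i) 2 (volume.restrict (Icc 0 M.τ)) := by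
  have hq : ∀ t ∈ Icc 0 M.τ, M.qt t (M.w t) ≠ 0 := fun t ht => (hM.qt_w_pos ht).ne'
  have hcongr : ∀ {g : ℝ → ℝ}, MemLp g 2 (volume.restrict (Icc 0 M.τ)) →
      (∀ u ∈ Icc 0 M.τ, g u = M.I i u) → MemLp (M.I i) 2 (volume.restrict (Icc 0 M.τ)) :=
    fun hg h => (memLp_congr_ae (ae_restrict_of_forall_mem measurableSet_Icc h)).1 hg
  fin_cases i
  · refine hcongr (memLp_continuousOn_mul ((continuousOn_const (c := M.c)).mul
      (hM.continuousOn_Fc_w.sqrt.div hM.continuousOn_qt_w hq)) hM.memLp_sqrt_b) fun u hu => ?_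
    simp [I, Real.sqrt_mul (hM.Fc_w_pos hu).le]
    ring
  · refine hcongr (ContinuousOn.memLp_Icc (((hM.continuousOn_s.mul
      (continuousOn_const (c := M.μ))).sqrt.div hM.continuousOn_qt_w hq).neg)) fun u hu => ?_
    simp [I, b]
    ring
  · refine hcongr (memLp_continuousOn_mul
      ((hM.continuousOn_F_w.sqrt.div hM.continuousOn_qt_w hq).neg) hM.memLp_sqrt_b) fun u hu => ?_
    simp [I, Real.sqrt_mul (hM.F_nonneg (hM.mapsTo_w hu))]
    ring

theorem memLp_J (hM : M.IsOverloaded) {t : ℝ} (ht : t ∈ Icc 0 M.τ) (i : Fin 3) :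
    MemLp (M.J i t) 2 (volume.restrict (Ioc 0 t)) := by
  have h := memLp_continuousOn_mul (hM.continuousOn_H ht) (hM.memLp_I i)
  have h' := h.mono_measure (Measure.restrict_mono_set volume
    (Ioc_subset_Icc_self.trans (Icc_subset_Icc_right ht.2) : Ioc 0 t ⊆ Icc 0 M.τ))
  convert h' using 2 with u
  exact mul_comm _ _

theorem mapsTo_age {a t : ℝ} : MapsTo (fun u => t - u) (Icc a t) (Ici 0) := fun _ hu =>
  sub_nonneg.2 hu.2

theorem continuousOn_lam_window (hM : M.IsOverloaded) {t : ℝ} (ht : t ∈ Icc 0 M.τ) :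
    ContinuousOn M.lam (Icc (t - M.w t) t) :=
  hM.lam_diff.continuousOn.mono (Icc_subset_Icc (hM.L_mem_Icc ht).1 ht.2)

theorem continuousOn_lam_past (hM : M.IsOverloaded) {t : ℝ} (ht : t ∈ Icc 0 M.τ) :
    ContinuousOn M.lam (Icc 0 (t - M.w t)) :=
  hM.lam_diff.continuousOn.mono (Icc_subset_Icc_right (hM.mapsTo_L ht).2)

theorem continuousOn_age (t : ℝ) (s : Set ℝ) : ContinuousOn (fun u : ℝ => t - u) s :=
  (continuous_const.sub continuous_id).continuousOn

theorem continuousOn_K₁_waiting (hM : M.IsOverloaded) {t : ℝ} (ht : t ∈ Icc 0 M.τ) :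
    ContinuousOn (fun u => M.c * M.Fc (t - u) * √(M.lam u)) (Icc (t - M.w t) t) :=
  ((continuousOn_const (c := M.c)).mul
    (hM.continuousOn_Fc.comp (continuousOn_age t _) mapsTo_age)).mul
    (hM.continuousOn_lam_window ht).sqrt

theorem continuousOn_K₃_waiting (hM : M.IsOverloaded) {t : ℝ} (ht : t ∈ Icc 0 M.τ) :
    ContinuousOn (fun u => -√(M.lam u * M.F (t - u) * M.Fc (t - u))) (Icc (t - M.w t) t) :=
  (((hM.continuousOn_lam_window ht).mul
    (hM.continuousOn_F.comp (continuousOn_age t _) mapsTo_age)).mul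
    (hM.continuousOn_Fc.comp (continuousOn_age t _) mapsTo_age)).sqrt.neg

theorem continuousOn_Ibar₁ (hM : M.IsOverloaded) : ContinuousOn M.Ibar₁ (Icc 0 M.τ) :=
  ((continuousOn_const (c := M.c)).mul hM.continuousOn_Fc_w).div hM.continuousOn_qt_w
    fun _ ht => (hM.qt_w_pos ht).ne'

theorem continuousOn_Ibar₃ (hM : M.IsOverloaded) : ContinuousOn M.Ibar₃ (Icc 0 M.τ) :=
  (hM.continuousOn_Fc_w.mul hM.continuousOn_F_w).sqrt.neg.div hM.continuousOn_qt_w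
    fun _ ht => (hM.qt_w_pos ht).ne'

theorem continuousOn_K_departed (hM : M.IsOverloaded) {t : ℝ} (ht : t ∈ Icc 0 M.τ) {g : ℝ → ℝ}
    (hg : ContinuousOn g (Icc 0 M.τ)) :
    ContinuousOn (fun u => M.qt t (M.w t) * √(M.lam u) * g (M.Linv u) * M.H t (M.Linv u))
      (Icc 0 (t - M.w t)) :=
  ((continuousOn_const.mul (hM.continuousOn_lam_past ht).sqrt).mul
    (hg.comp (hM.continuousOn_Linv ht) (hM.mapsTo_Linv ht))).mul
    ((hM.continuousOn_H ht).comp (hM.continuousOn_Linv ht) (hM.mapsTo_Linv ht))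

theorem memLp_K (hM : M.IsOverloaded) {t : ℝ} (ht : t ∈ Icc 0 M.τ) (i : Fin 3) :
    MemLp (M.K i t) 2 (volume.restrict (Ioc 0 t)) := by
  fin_cases i
  · exact memLp_indicator_add_indicator (hM.continuousOn_K₁_waiting ht)
      (hM.continuousOn_K_departed ht hM.continuousOn_Ibar₁)
  · exact (hM.memLp_J ht 1).const_mul _
  · exact memLp_indicator_add_indicator (hM.continuousOn_K₃_waiting ht)
      (hM.continuousOn_K_departed ht hM.continuousOn_Ibar₃)

/-- The substitution `u = L(s)` turns the part of `K₁` or `K₃` that stems from the customers who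
have left the queue into the kernel `J₁` or `J₃`. -/
theorem integral_K_departed_sq (hM : M.IsOverloaded) {t : ℝ} (ht : t ∈ Icc 0 M.τ) {g : ℝ → ℝ}
    {i : Fin 3}
    (hg : ∀ s ∈ Icc 0 M.τ, M.b s / M.qt s (M.w s) * (M.lam (M.L s) * g s ^ 2) = M.I i s ^ 2) :
    ∫ u in (0 : ℝ)..t - M.w t,
        (M.qt t (M.w t) * √(M.lam u) * g (M.Linv u) * M.H t (M.Linv u)) ^ 2 =
      M.qt t (M.w t) ^ 2 * ∫ u in (0 : ℝ)..t, M.J i t u ^ 2 := by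
  refine (hM.integral_comp_L ht _).trans ?_
  rw [← intervalIntegral.integral_const_mul]
  refine intervalIntegral.integral_congr fun s hs => ?_
  rw [uIcc_of_le ht.1] at hs
  have hs' : s ∈ Icc 0 M.τ := ⟨hs.1, hs.2.trans ht.2⟩
  simp only [hM.Linv_L hs', mul_pow, Real.sq_sqrt (hM.lam_L_pos hs').le, J, ← hg s hs']
  ring

theorem Ibar₁_sq (hM : M.IsOverloaded) {s : ℝ} (hs : s ∈ Icc 0 M.τ) :
    M.b s / M.qt s (M.w s) * (M.lam (M.L s) * M.Ibar₁ s ^ 2) = M.I 0 s ^ 2 := by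
  have h1 := hM.lam_L_pos hs
  have h2 := hM.Fc_w_pos hs
  have hq : M.qt s (M.w s) = M.lam (M.L s) * M.Fc (M.w s) := rfl
  simp only [Ibar₁, I, Matrix.cons_val_zero, div_pow, mul_pow,
    Real.sq_sqrt (mul_pos h2 (hM.b_pos hs)).le, hq]
  field_simp

theorem Ibar₃_sq (hM : M.IsOverloaded) {s : ℝ} (hs : s ∈ Icc 0 M.τ) :
    M.b s / M.qt s (M.w s) * (M.lam (M.L s) * M.Ibar₃ s ^ 2) = M.I 2 s ^ 2 := by
  have h1 := hM.lam_L_pos hs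
  have h2 := hM.Fc_w_pos hs
  have h3 := hM.F_nonneg (hM.mapsTo_w hs)
  have hq : M.qt s (M.w s) = M.lam (M.L s) * M.Fc (M.w s) := rfl
  have hI : M.I 2 s = -√(M.F (M.w s) * M.b s) / M.qt s (M.w s) := rfl
  simp only [Ibar₃, hI, div_pow, neg_sq, Real.sq_sqrt (mul_nonneg h3 (hM.b_pos hs).le),
    Real.sq_sqrt (mul_nonneg h2.le h3), hq]
  field_simp

theorem intervalIntegrable_sq {t : ℝ} (ht : 0 ≤ t) {g : ℝ → ℝ}
    (hg : MemLp g 2 (volume.restrict (Ioc 0 t))) :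
    IntervalIntegrable (fun u => g u ^ 2) volume 0 t :=
  (intervalIntegrable_iff_integrableOn_Ioc_of_le ht).2 hg.integrable_sq

theorem integral_sum_K_sq (hM : M.IsOverloaded) {t : ℝ} (ht : t ∈ Icc 0 M.τ) :
    ∫ u in (0 : ℝ)..t, ∑ i, M.K i t u ^ 2 =
      (∫ u in (t - M.w t)..t,
        M.lam u * M.Fc (t - u) * (M.c ^ 2 * M.Fc (t - u) + M.F (t - u))) +
      M.qt t (M.w t) ^ 2 * ∫ u in (0 : ℝ)..t, ∑ i, M.J i t u ^ 2 := by
  have hL := hM.L_mem_Icc ht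
  rw [intervalIntegral.integral_finsetSum
      fun i _ => intervalIntegrable_sq ht.1 (hM.memLp_K ht i),
    intervalIntegral.integral_finsetSum
      fun i _ => intervalIntegrable_sq ht.1 (hM.memLp_J ht i), Fin.sum_univ_three,
    Fin.sum_univ_three]
  have e1 : ∫ u in (0 : ℝ)..t, M.K 0 t u ^ 2 =
      M.qt t (M.w t) ^ 2 * (∫ u in (0 : ℝ)..t, M.J 0 t u ^ 2) +
        ∫ u in (t - M.w t)..t, (M.c * M.Fc (t - u) * √(M.lam u)) ^ 2 := by
    rw [← hM.integral_K_departed_sq ht fun s hs => hM.Ibar₁_sq hs]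
    exact integral_indicator_add_indicator_sq hL (hM.continuousOn_K₁_waiting ht)
      (hM.continuousOn_K_departed ht hM.continuousOn_Ibar₁)
  have e2 : ∫ u in (0 : ℝ)..t, M.K 1 t u ^ 2 =
      M.qt t (M.w t) ^ 2 * (∫ u in (0 : ℝ)..t, M.J 1 t u ^ 2) := by
    rw [← intervalIntegral.integral_const_mul]
    refine intervalIntegral.integral_congr fun u _ => ?_
    exact mul_pow (M.qt t (M.w t)) (M.J 1 t u) 2
  have e3 : ∫ u in (0 : ℝ)..t, M.K 2 t u ^ 2 =
      M.qt t (M.w t) ^ 2 * (∫ u in (0 : ℝ)..t, M.J 2 t u ^ 2) +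
        ∫ u in (t - M.w t)..t, (-√(M.lam u * M.F (t - u) * M.Fc (t - u))) ^ 2 := by
    rw [← hM.integral_K_departed_sq ht fun s hs => hM.Ibar₃_sq hs]
    exact integral_indicator_add_indicator_sq hL (hM.continuousOn_K₃_waiting ht)
      (hM.continuousOn_K_departed ht hM.continuousOn_Ibar₃)
  have e4 : ∫ u in (t - M.w t)..t,
        M.lam u * M.Fc (t - u) * (M.c ^ 2 * M.Fc (t - u) + M.F (t - u)) =
      (∫ u in (t - M.w t)..t, (M.c * M.Fc (t - u) * √(M.lam u)) ^ 2) +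
        ∫ u in (t - M.w t)..t, (-√(M.lam u * M.F (t - u) * M.Fc (t - u))) ^ 2 := by
    refine Eq.trans ?_ (intervalIntegral.integral_add
      (((hM.continuousOn_K₁_waiting ht).pow 2).intervalIntegrable_of_Icc hL.2)
      (((hM.continuousOn_K₃_waiting ht).pow 2).intervalIntegrable_of_Icc hL.2))
    refine intervalIntegral.integral_congr fun u hu => ?_
    change u ∈ uIcc (M.L t) t at hu
    rw [uIcc_of_le hL.2] at hu
    have h1 := (hM.lam_pos u ⟨hL.1.trans hu.1, hu.2.trans ht.2⟩).le
    have h2 : 0 ≤ t - u := sub_nonneg.2 hu.2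
    simp only [mul_pow, neg_sq, Real.sq_sqrt h1,
      Real.sq_sqrt (mul_nonneg (mul_nonneg h1 (hM.F_nonneg h2)) (hM.Fc_pos h2).le)]
    ring
  rw [e1, e2, e3, e4]
  ring

end FluidData.IsOverloaded

/-! ### Variances of the limit processes -/

theorem variance_add_mul_const_of_covariance_eq_zero {Ω : Type*} [MeasurableSpace Ω]
    {P : Measure Ω} [IsFiniteMeasure P] {U Z : Ω → ℝ} (hU : MemLp U 2 P) (hZ : MemLp Z 2 P)
    (h : cov[U, Z; P] = 0) (k : ℝ) :
    Var[fun ω => U ω + Z ω * k; P] = Var[U; P] + Var[Z; P] * k ^ 2 := by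
  rw [variance_fun_add hU (hZ.mul_const k), covariance_mul_const_right, h, variance_mul_const]
  ring

theorem variance_div_const {Ω : Type*} [MeasurableSpace Ω] {P : Measure Ω} (d : ℝ) (U : Ω → ℝ) :
    Var[fun ω => U ω / d; P] = Var[U; P] / d ^ 2 := by
  simp only [div_eq_mul_inv, variance_mul_const, inv_pow]

namespace FluidData.IsOverloaded

variable {M : FluidData} {Ω : Type*} [MeasurableSpace Ω] {P : Measure Ω}
  {B : Fin 3 → ℝ≥0 → Ω → ℝ} {X0 : Ω → ℝ}

theorem one_sub_wdot (t : ℝ) : 1 - M.wdot t = M.b t / M.qt t (M.w t) := by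
  simp [wdot]

/-- Fluid that enters service at time `t` arrived at time `L(t)`, so the potential waiting time at
`L(t)` ends at `t`. -/
theorem L_add_v (hM : M.IsOverloaded) {t : ℝ} (ht : t ∈ Icc 0 M.τ) : M.L t + M.v (M.L t) = t := by
  have h : M.v (M.L t) = M.w t := hM.v_eq t ht
  rw [h, L, sub_add_cancel]

theorem variance_Vstar (t : ℝ) :
    Var[M.Vstar P B t; P] =
      Var[M.Wstar P B (t + M.v t); P] / (1 - M.wdot (t + M.v t)) ^ 2 :=
  variance_div_const _ _

theorem variance_What (t : ℝ) :
    Var[M.What P B X0 t; P] = (1 - M.wdot t) ^ 2 * Var[M.Vhat P B X0 (t - M.w t); P] :=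
  variance_const_mul _ _ _

variable [IsProbabilityMeasure P]

theorem memLp_Wstar (hM : M.IsOverloaded) (hB : ∀ i, IsPreBrownianReal (B i) P) {t : ℝ}
    (ht : t ∈ Icc 0 M.τ) : MemLp (M.Wstar P B t) 2 P :=
  memLp_finsetSum _ fun i _ => memLp_wienerIntegral (hB i) ht.1 (hM.memLp_J ht i)

theorem variance_Vhat (hM : M.IsOverloaded) (hB : ∀ i, IsPreBrownianReal (B i) P)
    (hX0 : MemLp X0 2 P) (hX0indep : IndepFun X0 (fun ω i t => B i t ω) P) {t : ℝ}
    (ht : t + M.v t ∈ Icc 0 M.τ) :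
    Var[M.Vhat P B X0 t; P] =
      Var[M.Vstar P B t; P] +
        Var[X0; P] * M.Fwc (t + M.v t) ^ 2 /
          (M.s (t + M.v t) * M.μ + M.sdot (t + M.v t)) ^ 2 := by
  have hcov : cov[M.Vstar P B t, X0; P] = 0 := by
    refine (covariance_fun_div_left (X := M.Wstar P B (t + M.v t)) _).trans ?_
    rw [show cov[M.Wstar P B (t + M.v t), X0; P] = 0 from
      covariance_sum_wienerIntegral_of_indepFun hB hX0 hX0indep ht.1 (hM.memLp_J ht), zero_div]
  have hV : MemLp (M.Vstar P B t) 2 P := by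
    have h := (hM.memLp_Wstar hB ht).mul_const (1 - M.wdot (t + M.v t))⁻¹
    simp only [← div_eq_mul_inv] at h
    exact h
  have h := variance_add_mul_const_of_covariance_eq_zero hV hX0 hcov
    (M.Fwc (t + M.v t) / (M.s (t + M.v t) * M.μ + M.sdot (t + M.v t)))
  rw [div_pow, ← mul_div_assoc] at h
  rw [← h]
  congr 1
  funext ω
  rw [Vhat, mul_div_assoc]

end FluidData.IsOverloaded

theorem corollary4p1 {Ω : Type*} [MeasurableSpace Ω] (P : Measure Ω) [IsProbabilityMeasure P]
    (M : FluidData) (hM : M.IsOverloaded)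
    (B : Fin 3 → ℝ≥0 → Ω → ℝ) (hB : ∀ i, IsBrownianReal (B i) P)
    (hBindep : iIndepFun (fun i ω t => B i t ω) P)
    (X0 : Ω → ℝ) (hX0 : MemLp X0 2 P)
    (hX0indep : IndepFun X0 (fun ω i t => B i t ω) P) :
    (∀ t ∈ Icc 0 M.τ,
      -- all integrals are those of square-integrable functions, all variances are finite
      (∀ i, MemLp (M.K i t) 2 (volume.restrict (Ioc 0 t)) ∧
        MemLp (M.J i t) 2 (volume.restrict (Ioc 0 t)) ∧
        MemLp (M.XstarComp P B i t) 2 P ∧ MemLp (M.WstarComp P B i t) 2 P) ∧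
      -- the number in system
      Var[M.Xhat P B X0 t; P] = Var[M.Xstar P B t; P] + Var[X0; P] * M.Fwc t ^ 2 ∧
      Var[M.Xstar P B t; P] = ∑ i, Var[M.XstarComp P B i t; P] ∧
      Var[M.Xstar P B t; P] = ∫ u in (0 : ℝ)..t, ∑ i, M.K i t u ^ 2 ∧
      Var[M.Xstar P B t; P] =
        (∫ u in (t - M.w t)..t,
          M.lam u * M.Fc (t - u) * (M.c ^ 2 * M.Fc (t - u) + M.F (t - u))) +
        M.qt t (M.w t) ^ 2 * Var[M.Wstar P B t; P] ∧
      -- the head-of-line waiting time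
      Var[M.Wstar P B t; P] = ∑ i, Var[M.WstarComp P B i t; P] ∧
      Var[M.Wstar P B t; P] = ∫ u in (0 : ℝ)..t, ∑ i, M.J i t u ^ 2 ∧
      Var[M.Wstar P B t; P] = ∫ u in (0 : ℝ)..t, M.H t u ^ 2 * M.Isq u ∧
      Var[M.What P B X0 t; P] =
        (1 - M.wdot t) ^ 2 * Var[M.Vhat P B X0 (t - M.w t); P] ∧
      Var[M.What P B X0 t; P] =
        Var[M.Wstar P B t; P] + Var[X0; P] * M.Fwc t ^ 2 / M.qt t (M.w t) ^ 2 ∧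
      -- the covariance of the number in system and the head-of-line waiting time
      cov[M.Xstar P B t, M.Wstar P B t; P] =
        ∑ i, cov[M.XstarComp P B i t, M.WstarComp P B i t; P] ∧
      cov[M.Xstar P B t, M.Wstar P B t; P] =
        ∫ u in (0 : ℝ)..t, ∑ i, M.J i t u * M.K i t u) ∧
    -- the potential waiting time, for the arrival times `t` with `t + v(t) ≤ τ`
    (∀ t ∈ Icc 0 (M.τ - M.w M.τ),
      Var[M.Vstar P B t; P] =
        Var[M.Wstar P B (t + M.v t); P] / (1 - M.wdot (t + M.v t)) ^ 2 ∧
      Var[M.Vhat P B X0 t; P] =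
        Var[M.Vstar P B t; P] +
          Var[X0; P] * M.Fwc (t + M.v t) ^ 2 /
            (M.s (t + M.v t) * M.μ + M.sdot (t + M.v t)) ^ 2) := by
  have hB' : ∀ i, IsPreBrownianReal (B i) P := fun i => (hB i).toIsPreBrownianReal
  refine ⟨fun t ht => ?_, fun t ht => ?_⟩
  · have hK := hM.memLp_K ht
    have hJ := hM.memLp_J ht
    have hXmem : MemLp (M.Xstar P B t) 2 P :=
      memLp_finsetSum _ fun i _ => memLp_wienerIntegral (hB' i) ht.1 (hK i)
    have hWmem := hM.memLp_Wstar hB' ht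
    have hXsum : Var[M.Xstar P B t; P] = ∑ i, Var[M.XstarComp P B i t; P] := by
      have h := covariance_sum_wienerIntegral hB' hBindep ht.1 hK hK
      simp only [covariance_self (memLp_wienerIntegral (hB' _) ht.1 (hK _)).aemeasurable] at h
      exact (covariance_self hXmem.aemeasurable).symm.trans h
    have hWsum : Var[M.Wstar P B t; P] = ∑ i, Var[M.WstarComp P B i t; P] := by
      have h := covariance_sum_wienerIntegral hB' hBindep ht.1 hJ hJ
      simp only [covariance_self (memLp_wienerIntegral (hB' _) ht.1 (hJ _)).aemeasurable] at h
      exact (covariance_self hWmem.aemeasurable).symm.trans h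
    have hXint : Var[M.Xstar P B t; P] = ∫ u in (0 : ℝ)..t, ∑ i, M.K i t u ^ 2 := by
      have h := sum_covariance_wienerIntegral hB' ht.1 hK hK
      simp only [covariance_self (memLp_wienerIntegral (hB' _) ht.1 (hK _)).aemeasurable,
        ← pow_two] at h
      exact hXsum.trans h
    have hWint : Var[M.Wstar P B t; P] = ∫ u in (0 : ℝ)..t, ∑ i, M.J i t u ^ 2 := by
      have h := sum_covariance_wienerIntegral hB' ht.1 hJ hJ
      simp only [covariance_self (memLp_wienerIntegral (hB' _) ht.1 (hJ _)).aemeasurable,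
        ← pow_two] at h
      exact hWsum.trans h
    have hcov : cov[M.Xstar P B t, M.Wstar P B t; P] =
        ∑ i, cov[M.XstarComp P B i t, M.WstarComp P B i t; P] :=
      covariance_sum_wienerIntegral hB' hBindep ht.1 hK hJ
    have hWhat : Var[M.What P B X0 t; P] =
        (1 - M.wdot t) ^ 2 * Var[M.Vhat P B X0 (t - M.w t); P] :=
      FluidData.IsOverloaded.variance_What t
    refine ⟨fun i => ⟨hK i, hJ i, memLp_wienerIntegral (hB' i) ht.1 (hK i),
      memLp_wienerIntegral (hB' i) ht.1 (hJ i)⟩, ?_, hXsum, hXint, ?_, hWsum, hWint, ?_, hWhat,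
      ?_, hcov, ?_⟩
    · exact variance_add_mul_const_of_covariance_eq_zero hXmem hX0
        (covariance_sum_wienerIntegral_of_indepFun hB' hX0 hX0indep ht.1 hK) _
    · rw [hXint, hWint, hM.integral_sum_K_sq ht]
    · rw [hWint]
      refine intervalIntegral.integral_congr fun u _ => ?_
      simp only [FluidData.J, FluidData.Isq, Finset.mul_sum, mul_pow, mul_comm]
    · have hv : t - M.w t + M.v (t - M.w t) = t := hM.L_add_v ht
      have h := hM.variance_Vhat hB' hX0 hX0indep (t := t - M.w t) (by rwa [hv])
      rw [hWhat, h, FluidData.IsOverloaded.variance_Vstar, hv,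
        FluidData.IsOverloaded.one_sub_wdot]
      have hb := hM.b_pos ht
      have hq := hM.qt_w_pos ht
      rw [show M.s t * M.μ + M.sdot t = M.b t from rfl]
      field_simp
    · rw [hcov]
      refine (sum_covariance_wienerIntegral hB' ht.1 hK hJ).trans ?_
      simp only [mul_comm]
  · refine ⟨FluidData.IsOverloaded.variance_Vstar t, hM.variance_Vhat hB' hX0 hX0indep ?_⟩
    -- every such `t` is `L r` for some `r` in `[0, τ]`, and then `t + v t = r`
    have ht' : t ∈ M.L '' Icc 0 M.τ := by
      rw [hM.image_L_Icc ⟨hM.τ_pos.le, le_rfl⟩]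
      exact ht
    obtain ⟨r, hr, rfl⟩ := ht'
    rwa [hM.L_add_v hr]
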